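/- **Theorem.** For $n\ge 0$ let $\mathrm{Cliff}(n)$, resp. $\mathrm{Cliff}(-n)$, be the real algebra generated by $x_1,\dots,x_n$ with $x_ix_j=-x_jx_i$ for $i\ne j$ and $x_i^2=-1$, resp. $x_i^2=1$, with the $\mathbb Z/2$-grading in which the $x_i$ are odd. Identify $\mathbb R^7$ with the imaginary octonions, and let $\epsilon(a,b,c)=\langle ab,c\rangle$, an alternating $3$-form on $\mathbb R^7$; in suitable orthonormal coordinates $$\epsilon=x_1x_2x_3+x_1x_4x_5+x_1x_6x_7+x_2x_4x_6+x_2x_7x_5+x_3x_7x_4+x_3x_6x_5 .$$ Let $G_2\subset \mathrm{SO}(7)$ be the stabilizer of $\epsilon$, let $\mathfrak g_2$ be its Lie algebra, and let $G_2$ act on $A=\mathrm{Cliff}(7)$ by the algebra automorphisms induced from its linear action on the span of $x_1,\dots,x_7$. A comoment map is a Lie algebra map $\mu^*\colon\mathfrak g_2\to A$ with even values (for the commutator bracket of $A$) such that the infinitesimal action of each $X\in\mathfrak g_2$ on $A$ is $[\mu^*(X),-]$. Write $\langle\mu^*\mathfrak g_2\rangle$ for the left ideal of $A$ generated by the image of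 $\mu^*$. View $\epsilon$ also as the element of $A$ given by the displayed cubic, and put $\theta=x_1x_2\cdots x_7$, $\bar\epsilon=\theta\epsilon$. 1. There is exactly one comoment map $\mu^*$, and $\langle\mu^*\mathfrak g_2\rangle$ is $G_2$-stable. The quantum Hamiltonian reduction $A/\!/G_2=(A/\langle\mu^*\mathfrak g_2\rangle)^{G_2}$, with product $[a][b]=[ab]$ and the induced grading, is therefore defined, and $A/\langle\mu^*\mathfrak g_2\rangle$ is a $\mathbb Z/2$-graded $A$-$(A/\!/G_2)$-bimodule. 2. The invariant algebra $A^{G_2}$ has basis $\{1,\epsilon,\bar\epsilon,\theta\}$, and every class in $A/\!/G_2$ has a representative in $A^{G_2}$. 3. The right action of $A/\!/G_2$ on $A/\langle\mu^*\mathfrak g_2\rangle$ identifies $A/\!/G_2$ with the algebra $\mathrm{End}_A(A/\langle\mu^*\mathfrak g_2\rangle)$, where endomorphisms are multiplied by $fg=g\circ f$. 4. There is an isomorphism of $\mathbb Z/2$-graded algebras $\mathrm{Cliff}(-1)\cong \mathrm{Cliff}(7)/\!/G_2$ taking the generator to the class of $\theta$. 5. The bimodule $A/\langle\mu^*\mathfrak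 g_2\rangle$ is a super Morita equivalence between $\mathrm{Cliff}(7)$ and $\mathrm{Cliff}(7)/\!/G_2$, and hence, through the isomorphism in 4, between $\mathrm{Cliff}(7)$ and $\mathrm{Cliff}(-1)$. Here a $\mathbb Z/2$-graded $A$-$B$-bimodule $M$ is a super Morita equivalence if there is a $\mathbb Z/2$-graded $B$-$A$-bimodule $N$ with grading-preserving bimodule isomorphisms $M\otimes_BN\cong A$ and $N\otimes_AM\cong B$. -/

import Mathlib

open scoped TensorProduct Quaternion Matrix

noncomputable section

/-! ### Super Morita theory over the real numbers

A superalgebra is a real algebra `A` with a `ZMod 2`-grading `𝒜` by real subspaces. -/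

section Morita

variable {A B : Type} [Ring A] [Algebra ℝ A] [Ring B] [Algebra ℝ B]

/-- A `ZMod 2`-graded `A`-`B`-bimodule: a left `A`-module on which `B` acts from the right by
`A`-linear maps, i.e. through an algebra map to the opposite of `End_A`, with a decomposition into
an even and an odd part to which both actions are adapted. -/
structure SuperBimodule (𝒜 : ZMod 2 → Submodule ℝ A) (ℬ : ZMod 2 → Submodule ℝ B) where
  carrier : Type
  [addCommGroup : AddCommGroup carrier]
  [moduleReal : Module ℝ carrier]
  [moduleLeft : Module A carrier]
  [isScalarTower : IsScalarTower ℝ A carrier]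
  right : B →ₐ[ℝ] (Module.End A carrier)ᵐᵒᵖ
  grading : ZMod 2 → Submodule ℝ carrier
  isCompl : IsCompl (grading 0) (grading 1)
  smul_mem : ∀ i j, ∀ a ∈ 𝒜 i, ∀ m ∈ grading j, a • m ∈ grading (i + j)
  right_mem : ∀ i j, ∀ b ∈ ℬ i, ∀ m ∈ grading j, (right b).unop m ∈ grading (j + i)

attribute [instance] SuperBimodule.addCommGroup SuperBimodule.moduleReal
  SuperBimodule.moduleLeft SuperBimodule.isScalarTower

namespace SuperBimodule

variable {C : Type} [Ring C] [Algebra ℝ C]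
variable {𝒜 : ZMod 2 → Submodule ℝ A} {ℬ : ZMod 2 → Submodule ℝ B} {𝒞 : ZMod 2 → Submodule ℝ C}

/-- The relations `m b ⊗ n = m ⊗ b n` cutting out `M ⊗_B N` from `M ⊗_ℝ N`. -/
def balancing (M : SuperBimodule 𝒜 ℬ) (N : SuperBimodule ℬ 𝒞) :
    Submodule ℝ (M.carrier ⊗[ℝ] N.carrier) :=
  Submodule.span ℝ
    {z | ∃ m b n, z = ((M.right b).unop m) ⊗ₜ[ℝ] n - m ⊗ₜ[ℝ] (b • n)}

/-- The tensor product `M ⊗_B N` over the noncommutative algebra `B`. -/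
abbrev Tensor (M : SuperBimodule 𝒜 ℬ) (N : SuperBimodule ℬ 𝒞) : Type :=
  (M.carrier ⊗[ℝ] N.carrier) ⧸ balancing M N

/-- The class of `m ⊗ n` in `M ⊗_B N`. -/
def tmul (M : SuperBimodule 𝒜 ℬ) (N : SuperBimodule ℬ 𝒞) (m : M.carrier) (n : N.carrier) :
    Tensor M N :=
  (balancing M N).mkQ (m ⊗ₜ[ℝ] n)

/-- `M ⊗_B N` is isomorphic to the identity bimodule `A`, by an isomorphism that commutes with the
left and the right action of `A` and preserves the (total) degree. -/
def TensorIsoIdentity (M : SuperBimodule 𝒜 ℬ) (N : SuperBimodule ℬ 𝒜) : Prop :=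
  ∃ e : Tensor M N ≃ₗ[ℝ] A,
    (∀ a m n, e (tmul M N (a • m) n) = a * e (tmul M N m n)) ∧
    (∀ a m n, e (tmul M N m ((N.right a).unop n)) = e (tmul M N m n) * a) ∧
    (∀ i j, ∀ m ∈ M.grading i, ∀ n ∈ N.grading j, e (tmul M N m n) ∈ 𝒜 (i + j))

/-- `M` is a super Morita equivalence between `A` and `B`: it has an inverse graded bimodule. -/
def IsMoritaEquivalence (M : SuperBimodule 𝒜 ℬ) : Prop :=
  ∃ N : SuperBimodule ℬ 𝒜, TensorIsoIdentity M N ∧ TensorIsoIdentity N M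

/-- Restriction of the right action along a grading-preserving algebra map `f : C → B`. -/
def restrictRight (M : SuperBimodule 𝒜 ℬ) (f : C →ₐ[ℝ] B)
    (hf : ∀ i, ∀ c ∈ 𝒞 i, f c ∈ ℬ i) : SuperBimodule 𝒜 𝒞 where
  carrier := M.carrier
  right := M.right.comp f
  grading := M.grading
  isCompl := M.isCompl
  smul_mem := M.smul_mem
  right_mem i j c hc m hm := M.right_mem i j (f c) (hf i c hc) m hm

end SuperBimodule

end Morita

/-! ### Quantum Hamiltonian reduction -/

section Reduction

variable {A : Type} [Ring A] [Algebra ℝ A] (𝒜 : ZMod 2 → Submodule ℝ A)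
variable {G : Type} [Group G] (ρ : G →* (A →ₐ[ℝ] A))
variable {𝔤 : Type} [LieRing 𝔤] [LieAlgebra ℝ 𝔤] (oneParam : 𝔤 → ℝ → G)

/-- A comoment map for an action `ρ` of `G` on a superalgebra `A`, where `oneParam X t = exp (t X)`
are the one-parameter subgroups: a map `μ : 𝔤 → A` of Lie (super)algebras such that the derivative
at `t = 0` of the action of `exp (t X)` is the inner derivation `[μ X, -]`. As `𝔤` is purely even,
`μ` has even values, on which the supercommutator `[μ X, -]` is the commutator. The derivative in
`A` is taken against all linear functionals. -/
structure ComomentMap where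
  toLinearMap : 𝔤 →ₗ[ℝ] A
  map_lie : ∀ X Y, toLinearMap ⁅X, Y⁆ =
    toLinearMap X * toLinearMap Y - toLinearMap Y * toLinearMap X
  even : ∀ X, toLinearMap X ∈ 𝒜 0
  hasDerivAt : ∀ (X : 𝔤) (a : A) (φ : A →ₗ[ℝ] ℝ),
    HasDerivAt (fun t : ℝ => φ (ρ (oneParam X t) a)) (φ (toLinearMap X * a - a * toLinearMap X)) 0

/-- The subalgebra `A^G`. -/
def fixedSubalgebra : Subalgebra ℝ A where
  carrier := {a | ∀ g, ρ g a = a}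
  mul_mem' ha hb g := by rw [map_mul, ha g, hb g]
  add_mem' ha hb g := by rw [map_add, ha g, hb g]
  algebraMap_mem' r g := by simp

namespace ComomentMap

variable {𝒜 ρ oneParam}
variable (μ : ComomentMap 𝒜 ρ oneParam)

/-- The left ideal `⟨μ 𝔤⟩` of `A`. -/
def leftIdeal : Ideal A := Ideal.span (Set.range μ.toLinearMap)

/-- The left module `A / ⟨μ 𝔤⟩`. -/
abbrev Quot : Type := A ⧸ μ.leftIdeal

theorem mem_of_functionals (I : Submodule ℝ A) (a : A)
    (h : ∀ φ : A →ₗ[ℝ] ℝ, (∀ x ∈ I, φ x = 0) → φ a = 0) : a ∈ I := by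
  by_contra ha
  obtain ⟨φ, h1, h2⟩ := Submodule.exists_le_ker_of_notMem ha
  exact h1 (h φ fun x hx => h2 hx)

theorem apply_mul_mem {a : A} (ha : ∀ g, ρ g a - a ∈ μ.leftIdeal) (X : 𝔤) :
    μ.toLinearMap X * a ∈ μ.leftIdeal := by
  have key : μ.toLinearMap X * a - a * μ.toLinearMap X ∈ μ.leftIdeal.restrictScalars ℝ := by
    refine mem_of_functionals _ _ fun φ hφ => ?_
    have hd := μ.hasDerivAt X a φ
    have hc : (fun t : ℝ => φ (ρ (oneParam X t) a)) = fun _ => φ a := by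
      funext t
      have := hφ _ (show ρ (oneParam X t) a - a ∈ _ from ha _)
      rwa [map_sub, sub_eq_zero] at this
    rw [hc] at hd
    exact hd.unique (hasDerivAt_const _ _)
  have h2 : a * μ.toLinearMap X ∈ μ.leftIdeal :=
    Ideal.mul_mem_left _ _ (Ideal.subset_span ⟨X, rfl⟩)
  have h3 : μ.toLinearMap X * a - a * μ.toLinearMap X ∈ μ.leftIdeal := key
  have := add_mem h3 h2
  rwa [sub_add_cancel] at this

theorem leftIdeal_mul_mem {a : A} (ha : ∀ g, ρ g a - a ∈ μ.leftIdeal) {x : A}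
    (hx : x ∈ μ.leftIdeal) : x * a ∈ μ.leftIdeal := by
  induction hx using Submodule.span_induction with
  | mem x hx =>
    obtain ⟨X, rfl⟩ := hx
    exact μ.apply_mul_mem ha X
  | zero => simp
  | add x y _ _ hx hy => rw [add_mul]; exact add_mem hx hy
  | smul b x _ hx => rw [smul_eq_mul, mul_assoc]; exact Ideal.mul_mem_left _ _ hx

/-- The elements of `A` whose class in `A / ⟨μ 𝔤⟩` is `G`-invariant. -/
def lifts : Subalgebra ℝ A where
  carrier := {a | ∀ g, ρ g a - a ∈ μ.leftIdeal}
  mul_mem' {a b} ha hb g := by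
    have : ρ g (a * b) - a * b = ρ g a * (ρ g b - b) + (ρ g a - a) * b := by
      rw [map_mul]; noncomm_ring
    rw [this]
    exact add_mem (Ideal.mul_mem_left _ _ (hb g)) (μ.leftIdeal_mul_mem hb (ha g))
  add_mem' {a b} ha hb g := by
    have : ρ g (a + b) - (a + b) = (ρ g a - a) + (ρ g b - b) := by rw [map_add]; abel
    rw [this]
    exact add_mem (ha g) (hb g)
  algebraMap_mem' r g := by simp

/-- `⟨μ 𝔤⟩` as an ideal of `lifts`. -/
def liftsIdeal : Ideal μ.lifts where
  carrier := {a | (a : A) ∈ μ.leftIdeal}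
  add_mem' ha hb := μ.leftIdeal.add_mem ha hb
  zero_mem' := μ.leftIdeal.zero_mem
  smul_mem' c _ hx := μ.leftIdeal.mul_mem_left (c : A) hx

instance : μ.liftsIdeal.IsTwoSided where
  mul_mem_of_left b ha := μ.leftIdeal_mul_mem b.2 ha

/-- The quantum Hamiltonian reduction `A // G = (A / ⟨μ 𝔤⟩)^G`: the `G`-invariant classes of
elements of `A` modulo `⟨μ 𝔤⟩`, with the product `[a] [b] = [a b]`. -/
abbrev Reduction : Type := μ.lifts ⧸ μ.liftsIdeal

/-- The grading of `A // G` induced from that of `A`. -/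
def reductionGrading (i : ZMod 2) : Submodule ℝ μ.Reduction :=
  ((𝒜 i).comap μ.lifts.val.toLinearMap).map (Ideal.Quotient.mkₐ ℝ μ.liftsIdeal).toLinearMap

/-- Right multiplication by `b` on `A / ⟨μ 𝔤⟩`, for `b` with a `G`-invariant class. -/
def rightMul (b : μ.lifts) : Module.End A μ.Quot :=
  μ.leftIdeal.mapQ μ.leftIdeal (LinearMap.toSpanSingleton A A (b : A))
    fun _ hx => μ.leftIdeal_mul_mem b.2 hx

theorem rightMul_mk (b : μ.lifts) (a : A) :
    μ.rightMul b (Submodule.Quotient.mk a) = Submodule.Quotient.mk (a * (b : A)) := rfl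

/-- The right action of `A // G` on `A / ⟨μ 𝔤⟩`, `[a] · [b] = [a b]`. It commutes with the left
action of `A`, so it is an algebra map to the algebra `End_A (A / ⟨μ 𝔤⟩)` with the product
`f g = g ∘ f`. -/
def rightAction : μ.Reduction →ₐ[ℝ] (Module.End A μ.Quot)ᵐᵒᵖ :=
  Ideal.Quotient.liftₐ μ.liftsIdeal
    { toFun := fun b => MulOpposite.op (μ.rightMul b)
      map_one' := by
        apply MulOpposite.unop_injective
        ext; simp [rightMul]
      map_mul' := fun b c => by
        apply MulOpposite.unop_injective
        apply LinearMap.ext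
        intro x
        obtain ⟨a, rfl⟩ := Submodule.Quotient.mk_surjective _ x
        simp [rightMul_mk, mul_assoc]
      map_zero' := by
        apply MulOpposite.unop_injective
        ext; simp [rightMul]
      map_add' := fun b c => by
        apply MulOpposite.unop_injective
        apply LinearMap.ext
        intro x
        obtain ⟨a, rfl⟩ := Submodule.Quotient.mk_surjective _ x
        simp [rightMul_mk, mul_add]
      commutes' := fun r => by
        apply MulOpposite.unop_injective
        apply LinearMap.ext
        intro x
        obtain ⟨a, rfl⟩ := Submodule.Quotient.mk_surjective _ x
        simp only [MulOpposite.unop_op, rightMul_mk, MulOpposite.algebraMap_apply,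
          Module.algebraMap_end_apply, Subalgebra.coe_algebraMap]
        rw [← Algebra.commutes, ← Algebra.smul_def]
        rfl }
    fun b hb => by
      apply MulOpposite.unop_injective
      apply LinearMap.ext
      intro x
      obtain ⟨a, rfl⟩ := Submodule.Quotient.mk_surjective _ x
      exact (Submodule.Quotient.mk_eq_zero _).2 (μ.leftIdeal.mul_mem_left a hb)

theorem rightAction_mk (b : μ.lifts) (a : A) :
    (μ.rightAction (Ideal.Quotient.mk _ b)).unop (Submodule.Quotient.mk a) =
      Submodule.Quotient.mk (a * (b : A)) := rfl

/-- The grading of `A / ⟨μ 𝔤⟩` induced from that of `A`. -/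
def quotGrading (i : ZMod 2) : Submodule ℝ μ.Quot :=
  (𝒜 i).map (μ.leftIdeal.mkQ.restrictScalars ℝ)

theorem leftIdeal_isHomogeneous [GradedAlgebra 𝒜] : μ.leftIdeal.IsHomogeneous 𝒜 :=
  Ideal.homogeneous_span 𝒜 _ fun _ ⟨X, hX⟩ => ⟨0, hX ▸ μ.even X⟩

theorem quotGrading_isCompl [GradedAlgebra 𝒜] :
    IsCompl (μ.quotGrading 0) (μ.quotGrading 1) := by
  constructor
  · rw [Submodule.disjoint_def]
    rintro _ ⟨a, ha, rfl⟩ ⟨b, hb, hab⟩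
    have h : b - a ∈ μ.leftIdeal := (Submodule.Quotient.eq _).1 hab
    have h0 := μ.leftIdeal_isHomogeneous 0 h
    rw [DirectSum.decompose_sub, DirectSum.sub_apply, AddSubgroupClass.coe_sub,
      DirectSum.decompose_of_mem_same 𝒜 ha,
      DirectSum.decompose_of_mem_ne 𝒜 hb (by decide), zero_sub, neg_mem_iff] at h0
    exact (Submodule.Quotient.mk_eq_zero _).2 h0
  · rw [codisjoint_iff, eq_top_iff]
    rintro x -
    obtain ⟨a, rfl⟩ := Submodule.Quotient.mk_surjective _ x
    classical
    rw [← DirectSum.sum_support_decompose 𝒜 a]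
    have : ∀ i : ZMod 2, μ.quotGrading i ≤ μ.quotGrading 0 ⊔ μ.quotGrading 1 := by
      intro i
      fin_cases i
      · exact le_sup_left
      · exact le_sup_right
    rw [← Submodule.mkQ_apply, map_sum]
    exact Submodule.sum_mem _ fun i _ => this i ⟨_, SetLike.coe_mem _, rfl⟩

/-- `A / ⟨μ 𝔤⟩` as a graded bimodule between `A` and `A // G`. -/
def bimodule [GradedAlgebra 𝒜] : SuperBimodule 𝒜 μ.reductionGrading where
  carrier := μ.Quot
  right := μ.rightAction
  grading := μ.quotGrading
  isCompl := μ.quotGrading_isCompl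
  smul_mem := by
    rintro i j a ha _ ⟨b, hb, rfl⟩
    exact ⟨a * b, SetLike.mul_mem_graded ha hb, rfl⟩
  right_mem := by
    rintro i j _ ⟨b, hb, rfl⟩ _ ⟨a, ha, rfl⟩
    exact ⟨a * b, SetLike.mul_mem_graded ha hb, rfl⟩

end ComomentMap

end Reduction

/-! ### Clifford algebras -/

section Clifford

/-- `Cliff(n)`, generated by anticommuting `x₁, …, xₙ` with square `-1`. -/
abbrev Cliff (n : ℕ) : Type :=
  CliffordAlgebra (QuadraticMap.weightedSumSquares ℝ (fun _ : Fin n => (-1 : ℝ)))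

/-- `Cliff(-n)`, generated by anticommuting `x₁, …, xₙ` with square `1`. -/
abbrev CliffNeg (n : ℕ) : Type :=
  CliffordAlgebra (QuadraticMap.weightedSumSquares ℝ (fun _ : Fin n => (1 : ℝ)))

/-- The grading of `Cliff(n)` in which the generators are odd. -/
abbrev cliffGrading (n : ℕ) : ZMod 2 → Submodule ℝ (Cliff n) := CliffordAlgebra.evenOdd _

/-- The grading of `Cliff(-n)` in which the generators are odd. -/
abbrev cliffNegGrading (n : ℕ) : ZMod 2 → Submodule ℝ (CliffNeg n) := CliffordAlgebra.evenOdd _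

/-- The generators of `Cliff(n)`. -/
def cliffGen {n : ℕ} (i : Fin n) : Cliff n := CliffordAlgebra.ι _ (Pi.single i 1)

/-- The generators of `Cliff(-n)`. -/
def cliffNegGen {n : ℕ} (i : Fin n) : CliffNeg n := CliffordAlgebra.ι _ (Pi.single i 1)

/-- A rotation, as an isometry of the quadratic space defining `Cliff(n)`. -/
def rotationIsometry {n : ℕ} (g : Matrix.specialOrthogonalGroup (Fin n) ℝ) :
    QuadraticMap.weightedSumSquares ℝ (fun _ : Fin n => (-1 : ℝ)) →qᵢ
      QuadraticMap.weightedSumSquares ℝ (fun _ : Fin n => (-1 : ℝ)) where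
  toLinearMap := Matrix.mulVecLin (g : Matrix (Fin n) (Fin n) ℝ)
  map_app' v := by
    have hg : (g : Matrix (Fin n) (Fin n) ℝ)ᵀ * g = 1 :=
      (Matrix.mem_orthogonalGroup_iff' _ _).1 (Matrix.mem_specialOrthogonalGroup_iff.1 g.2).1
    have h : ((g : Matrix (Fin n) (Fin n) ℝ) *ᵥ v) ⬝ᵥ ((g : Matrix (Fin n) (Fin n) ℝ) *ᵥ v)
        = v ⬝ᵥ v := by
      rw [Matrix.dotProduct_mulVec, Matrix.vecMul_mulVec, hg, Matrix.vecMul_one]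
    simp only [dotProduct] at h
    simp [QuadraticMap.weightedSumSquares_apply, h]

/-- The action of `SO(n)` on `Cliff(n)` by algebra automorphisms, induced from the linear action on
the span of the generators. -/
def rotationAction (n : ℕ) :
    Matrix.specialOrthogonalGroup (Fin n) ℝ →* (Cliff n →ₐ[ℝ] Cliff n) where
  toFun g := CliffordAlgebra.map (rotationIsometry g)
  map_one' := by
    apply CliffordAlgebra.hom_ext
    ext i
    simp [rotationIsometry]
  map_mul' g h := by
    apply CliffordAlgebra.hom_ext
    ext i
    change CliffordAlgebra.map (rotationIsometry (g * h)) (CliffordAlgebra.ι _ (Pi.single i 1)) =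
      CliffordAlgebra.map (rotationIsometry g)
        (CliffordAlgebra.map (rotationIsometry h) (CliffordAlgebra.ι _ (Pi.single i 1)))
    simp only [CliffordAlgebra.map_apply_ι]
    congr 1
    exact (Matrix.mulVec_mulVec (Pi.single i 1) (g : Matrix (Fin n) (Fin n) ℝ)
      (h : Matrix (Fin n) (Fin n) ℝ)).symm

end Clifford

/-! ### Octonions, `G₂` and its Lie algebra -/

section G2

attribute [local instance] LieRing.ofAssociativeRing

/-- The product of the octonions `𝕆 = ℍ × ℍ` (Cayley--Dickson doubling of the quaternions). -/
def octMul (x y : ℍ[ℝ] × ℍ[ℝ]) : ℍ[ℝ] × ℍ[ℝ] :=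
  (x.1 * y.1 - star y.2 * x.2, y.2 * x.1 + x.2 * star y.1)

/-- The Euclidean inner product of the octonions. -/
def octInner (x y : ℍ[ℝ] × ℍ[ℝ]) : ℝ := (x.1 * star y.1).re + (x.2 * star y.2).re

/-- The identification of `ℝ⁷` with the imaginary octonions: the unit vectors `e₁, …, e₇` go to
`(i, 0), (j, 0), (k, 0), (0, 1), (0, i), (0, j), (0, -k)`. -/
def imOct (v : Fin 7 → ℝ) : ℍ[ℝ] × ℍ[ℝ] := (⟨0, v 0, v 1, v 2⟩, ⟨v 3, v 4, v 5, -v 6⟩)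

/-- The alternating `3`-form `ε(a, b, c) = ⟨a b, c⟩` on the imaginary octonions. -/
def octForm (a b c : Fin 7 → ℝ) : ℝ := octInner (octMul (imOct a) (imOct b)) (imOct c)

/-- The form `ε` is
`e₁₂₃ + e₁₄₅ + e₁₆₇ + e₂₄₆ + e₂₇₅ + e₃₇₄ + e₃₆₅`, where `eᵢⱼₖ` is the `3 × 3` minor with columns
`i, j, k`. -/
theorem octForm_eq (a b c : Fin 7 → ℝ) :
    octForm a b c =
      (([(0, 1, 2), (0, 3, 4), (0, 5, 6), (1, 3, 5), (1, 6, 4), (2, 6, 3), (2, 5, 4)] :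
        List (Fin 7 × Fin 7 × Fin 7)).map fun p =>
          !![a p.1, a p.2.1, a p.2.2; b p.1, b p.2.1, b p.2.2; c p.1, c p.2.1, c p.2.2].det).sum := by
  have h0 (v) : (imOct v).1.re = 0 := rfl
  have h1 (v) : (imOct v).1.imI = v 0 := rfl
  have h2 (v) : (imOct v).1.imJ = v 1 := rfl
  have h3 (v) : (imOct v).1.imK = v 2 := rfl
  have h4 (v) : (imOct v).2.re = v 3 := rfl
  have h5 (v) : (imOct v).2.imI = v 4 := rfl
  have h6 (v) : (imOct v).2.imJ = v 5 := rfl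
  have h7 (v) : (imOct v).2.imK = -v 6 := rfl
  simp [octForm, octInner, octMul, h0, h1, h2, h3, h4, h5, h6, h7, Matrix.det_fin_three]
  ring

/-- `G₂`, the subgroup of `SO(7)` preserving `ε`. -/
def G2 : Subgroup (Matrix.specialOrthogonalGroup (Fin 7) ℝ) where
  carrier := {g | ∀ a b c : Fin 7 → ℝ,
    octForm ((g : Matrix (Fin 7) (Fin 7) ℝ) *ᵥ a) ((g : Matrix (Fin 7) (Fin 7) ℝ) *ᵥ b)
      ((g : Matrix (Fin 7) (Fin 7) ℝ) *ᵥ c) = octForm a b c}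
  mul_mem' {g h} hg hh a b c := by
    simp only [Submonoid.coe_mul, ← Matrix.mulVec_mulVec]
    rw [hg, hh]
  one_mem' a b c := by simp
  inv_mem' {g} hg a b c := by
    have h : (g : Matrix (Fin 7) (Fin 7) ℝ) *
        ((g⁻¹ : Matrix.specialOrthogonalGroup (Fin 7) ℝ) : Matrix (Fin 7) (Fin 7) ℝ) = 1 := by
      rw [← Submonoid.coe_mul, mul_inv_cancel, Submonoid.coe_one]
    rw [← hg]
    simp [Matrix.mulVec_mulVec, h]

theorem octForm_add₁ (a a' b c : Fin 7 → ℝ) :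
    octForm (a + a') b c = octForm a b c + octForm a' b c := by
  simp [octForm_eq, Matrix.det_fin_three]; ring

theorem octForm_add₂ (a b b' c : Fin 7 → ℝ) :
    octForm a (b + b') c = octForm a b c + octForm a b' c := by
  simp [octForm_eq, Matrix.det_fin_three]; ring

theorem octForm_add₃ (a b c c' : Fin 7 → ℝ) :
    octForm a b (c + c') = octForm a b c + octForm a b c' := by
  simp [octForm_eq, Matrix.det_fin_three]; ring

theorem octForm_smul₁ (r : ℝ) (a b c : Fin 7 → ℝ) :
    octForm (r • a) b c = r * octForm a b c := by
  simp [octForm_eq, Matrix.det_fin_three]; ring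

theorem octForm_smul₂ (r : ℝ) (a b c : Fin 7 → ℝ) :
    octForm a (r • b) c = r * octForm a b c := by
  simp [octForm_eq, Matrix.det_fin_three]; ring

theorem octForm_smul₃ (r : ℝ) (a b c : Fin 7 → ℝ) :
    octForm a b (r • c) = r * octForm a b c := by
  simp [octForm_eq, Matrix.det_fin_three]; ring

theorem octForm_eq_sum (a b c : Fin 7 → ℝ) :
    octForm a b c = ∑ i, ∑ j, ∑ k, a i * (b j * (c k *
      octForm (fun l => if i = l then 1 else 0) (fun l => if j = l then 1 else 0)
        (fun l => if k = l then 1 else 0))) := by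
  have h1 (a b c : Fin 7 → ℝ) : octForm a b c =
      ∑ i, a i * octForm (fun l => if i = l then 1 else 0) b c :=
    LinearMap.pi_apply_eq_sum_univ
      (⟨⟨fun a => octForm a b c, fun _ _ => octForm_add₁ _ _ _ _⟩,
        fun _ _ => octForm_smul₁ _ _ _ _⟩ : (Fin 7 → ℝ) →ₗ[ℝ] ℝ) a
  have h2 (a b c : Fin 7 → ℝ) : octForm a b c =
      ∑ i, b i * octForm a (fun l => if i = l then 1 else 0) c :=
    LinearMap.pi_apply_eq_sum_univ
      (⟨⟨fun b => octForm a b c, fun _ _ => octForm_add₂ _ _ _ _⟩,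
        fun _ _ => octForm_smul₂ _ _ _ _⟩ : (Fin 7 → ℝ) →ₗ[ℝ] ℝ) b
  have h3 (a b c : Fin 7 → ℝ) : octForm a b c =
      ∑ i, c i * octForm a b (fun l => if i = l then 1 else 0) :=
    LinearMap.pi_apply_eq_sum_univ
      (⟨⟨fun c => octForm a b c, fun _ _ => octForm_add₃ _ _ _ _⟩,
        fun _ _ => octForm_smul₃ _ _ _ _⟩ : (Fin 7 → ℝ) →ₗ[ℝ] ℝ) c
  rw [h1]
  refine Finset.sum_congr rfl fun i _ => ?_
  rw [h2, Finset.mul_sum]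
  refine Finset.sum_congr rfl fun j _ => ?_
  rw [h3, Finset.mul_sum, Finset.mul_sum]

theorem hasDerivAt_octForm {a b c : ℝ → Fin 7 → ℝ} {a' b' c' : Fin 7 → ℝ} {t : ℝ}
    (ha : HasDerivAt a a' t) (hb : HasDerivAt b b' t) (hc : HasDerivAt c c' t) :
    HasDerivAt (fun s => octForm (a s) (b s) (c s))
      (octForm a' (b t) (c t) + octForm (a t) b' (c t) + octForm (a t) (b t) c') t := by
  rw [hasDerivAt_pi] at ha hb hc
  have e : (fun s => octForm (a s) (b s) (c s)) = fun s => _ :=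
    funext fun s => octForm_eq_sum (a s) (b s) (c s)
  rw [e, octForm_eq_sum a', octForm_eq_sum (a t) b', octForm_eq_sum (a t) (b t) c']
  simp only [← Finset.sum_add_distrib]
  refine HasDerivAt.fun_sum fun i _ => HasDerivAt.fun_sum fun j _ => HasDerivAt.fun_sum fun k _ => ?_
  refine ((ha i).mul ((hb j).mul ((hc k).mul_const _))).congr_deriv ?_
  simp only [Pi.mul_apply]
  ring

section
open scoped Matrix.Norms.Operator

theorem hasDerivAt_exp_mulVec (X : Matrix (Fin 7) (Fin 7) ℝ) (v : Fin 7 → ℝ) (t : ℝ) :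
    HasDerivAt (fun s : ℝ => NormedSpace.exp (s • X) *ᵥ v)
      (X *ᵥ (NormedSpace.exp (t • X) *ᵥ v)) t := by
  have h := hasDerivAt_exp_smul_const' (𝕂 := ℝ) X t
  let L : Matrix (Fin 7) (Fin 7) ℝ →ₗ[ℝ] (Fin 7 → ℝ) :=
    ⟨⟨fun M => M *ᵥ v, fun _ _ => Matrix.add_mulVec _ _ _⟩, fun r M => Matrix.smul_mulVec r M v⟩
  have := (LinearMap.toContinuousLinearMap L).hasFDerivAt.comp_hasDerivAt t h
  exact this.congr_deriv (Matrix.mulVec_mulVec v X (NormedSpace.exp (t • X))).symm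

end

/-- `exp (t X)` lies in `G₂`. -/
def ExpMemG2 (X : Matrix (Fin 7) (Fin 7) ℝ) (t : ℝ) : Prop :=
  ∃ h : NormedSpace.exp (t • X) ∈ Matrix.specialOrthogonalGroup (Fin 7) ℝ, ⟨_, h⟩ ∈ G2

theorem forall_expMemG2_iff (X : Matrix (Fin 7) (Fin 7) ℝ) :
    (∀ t, ExpMemG2 X t) ↔ Xᵀ = -X ∧ ∀ a b c : Fin 7 → ℝ,
      octForm (X *ᵥ a) b c + octForm a (X *ᵥ b) c + octForm a b (X *ᵥ c) = 0 := by
  constructor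
  · intro h
    constructor
    · have key (v w : Fin 7 → ℝ) : (X *ᵥ v) ⬝ᵥ w + v ⬝ᵥ (X *ᵥ w) = 0 := by
        have hv := hasDerivAt_exp_mulVec X v 0
        have hw := hasDerivAt_exp_mulVec X w 0
        simp only [zero_smul, NormedSpace.exp_zero, Matrix.one_mulVec] at hv hw
        rw [hasDerivAt_pi] at hv hw
        have hd : HasDerivAt (fun s : ℝ => ∑ i, (NormedSpace.exp (s • X) *ᵥ v) i *
            (NormedSpace.exp (s • X) *ᵥ w) i) (∑ i, ((X *ᵥ v) i * w i + v i * (X *ᵥ w) i)) 0 :=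
          HasDerivAt.fun_sum fun i _ => ((hv i).mul (hw i)).congr_deriv (by simp)
        have hc : (fun s : ℝ => ∑ i, (NormedSpace.exp (s • X) *ᵥ v) i *
            (NormedSpace.exp (s • X) *ᵥ w) i) = fun _ => v ⬝ᵥ w := by
          funext s
          obtain ⟨hs, -⟩ := h s
          have ho := (Matrix.mem_orthogonalGroup_iff' _ _).1
            (Matrix.mem_specialOrthogonalGroup_iff.1 hs).1
          change (NormedSpace.exp (s • X) *ᵥ v) ⬝ᵥ (NormedSpace.exp (s • X) *ᵥ w) = _
          rw [Matrix.dotProduct_mulVec, Matrix.vecMul_mulVec, ho, Matrix.vecMul_one]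
        rw [hc] at hd
        have := hd.unique (hasDerivAt_const _ _)
        simpa [dotProduct, Finset.sum_add_distrib] using this
      ext i j
      have := key (Pi.single i 1) (Pi.single j 1)
      simp at this
      simp only [Matrix.transpose_apply, Matrix.neg_apply]
      linarith
    · intro a b c
      have hd := hasDerivAt_octForm (hasDerivAt_exp_mulVec X a 0) (hasDerivAt_exp_mulVec X b 0)
        (hasDerivAt_exp_mulVec X c 0)
      have hc : (fun s : ℝ => octForm (NormedSpace.exp (s • X) *ᵥ a) (NormedSpace.exp (s • X) *ᵥ b)
          (NormedSpace.exp (s • X) *ᵥ c)) = fun _ => octForm a b c :=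
        funext fun s => (h s).snd a b c
      rw [hc] at hd
      simpa using hd.unique (hasDerivAt_const _ _)
  · rintro ⟨h1, h2⟩ t
    have ho (s : ℝ) : NormedSpace.exp (s • X) ∈ Matrix.orthogonalGroup (Fin 7) ℝ := by
      rw [Matrix.mem_orthogonalGroup_iff, ← Matrix.exp_transpose, Matrix.transpose_smul, h1,
        ← Matrix.exp_add_of_commute]
      · simp
      · exact ((Commute.refl X).neg_right.smul_left s).smul_right s
    have hdet : (NormedSpace.exp (t • X)).det = 1 := by
      have hsq : NormedSpace.exp (t • X) =
          NormedSpace.exp ((t / 2) • X) * NormedSpace.exp ((t / 2) • X) := by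
        rw [← Matrix.exp_add_of_commute _ _ (Commute.refl _), ← add_smul, add_halves]
      have hh := (Matrix.mem_orthogonalGroup_iff _ _).1 (ho (t / 2))
      rw [hsq, Matrix.det_mul]
      have := congrArg Matrix.det hh
      rwa [Matrix.det_mul, Matrix.det_transpose, Matrix.det_one] at this
    refine ⟨Matrix.mem_specialOrthogonalGroup_iff.2 ⟨ho t, hdet⟩, fun a b c => ?_⟩
    have hd (s : ℝ) := hasDerivAt_octForm (hasDerivAt_exp_mulVec X a s)
      (hasDerivAt_exp_mulVec X b s) (hasDerivAt_exp_mulVec X c s)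
    simp only [h2] at hd
    have := is_const_of_deriv_eq_zero (fun s => (hd s).differentiableAt) (fun s => (hd s).deriv) t 0
    simpa using this

/-- The Lie algebra `𝔤₂` of `G₂`: the matrices `X` with `exp (t X) ∈ G₂` for all real `t`, with the
commutator bracket. -/
def g2 : LieSubalgebra ℝ (Matrix (Fin 7) (Fin 7) ℝ) where
  carrier := {X | ∀ t, ExpMemG2 X t}
  add_mem' {X Y} hX hY := by
    simp only [Set.mem_ofPred_eq, forall_expMemG2_iff] at *
    refine ⟨by rw [Matrix.transpose_add, hX.1, hY.1, neg_add], fun a b c => ?_⟩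
    simp only [Matrix.add_mulVec, octForm_add₁, octForm_add₂, octForm_add₃]
    linarith [hX.2 a b c, hY.2 a b c]
  zero_mem' := by
    simp only [Set.mem_ofPred_eq, forall_expMemG2_iff]
    refine ⟨by simp, fun a b c => ?_⟩
    simp [octForm_eq, Matrix.det_fin_three]
  smul_mem' r X hX := by
    simp only [Set.mem_ofPred_eq, forall_expMemG2_iff] at *
    refine ⟨by rw [Matrix.transpose_smul, hX.1, smul_neg], fun a b c => ?_⟩
    simp only [Matrix.smul_mulVec, octForm_smul₁, octForm_smul₂, octForm_smul₃]
    linear_combination r * hX.2 a b c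
  lie_mem' {X Y} hX hY := by
    change ∀ t, ExpMemG2 _ t
    change ∀ t, ExpMemG2 _ t at hX
    change ∀ t, ExpMemG2 _ t at hY
    rw [forall_expMemG2_iff] at *
    rw [Ring.lie_def]
    refine ⟨by rw [Matrix.transpose_sub, Matrix.transpose_mul, Matrix.transpose_mul, hX.1, hY.1];
               noncomm_ring, fun a b c => ?_⟩
    have hs₁ (a a' b c) : octForm (a - a') b c = octForm a b c - octForm a' b c := by
      rw [eq_sub_iff_add_eq, ← octForm_add₁, sub_add_cancel]
    have hs₂ (a b b' c) : octForm a (b - b') c = octForm a b c - octForm a b' c := by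
      rw [eq_sub_iff_add_eq, ← octForm_add₂, sub_add_cancel]
    have hs₃ (a b c c') : octForm a b (c - c') = octForm a b c - octForm a b c' := by
      rw [eq_sub_iff_add_eq, ← octForm_add₃, sub_add_cancel]
    simp only [Matrix.sub_mulVec, ← Matrix.mulVec_mulVec, hs₁, hs₂, hs₃]
    linarith [hX.2 (Y *ᵥ a) b c, hX.2 a (Y *ᵥ b) c, hX.2 a b (Y *ᵥ c),
      hY.2 (X *ᵥ a) b c, hY.2 a (X *ᵥ b) c, hY.2 a b (X *ᵥ c)]

theorem mem_g2 {X : Matrix (Fin 7) (Fin 7) ℝ} : X ∈ g2 ↔ ∀ t, ExpMemG2 X t := Iff.rfl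

/-- The one-parameter subgroup `t ↦ exp (t X)` of `G₂`. -/
def g2Exp (X : g2) (t : ℝ) : G2 :=
  ⟨⟨NormedSpace.exp (t • (X : Matrix (Fin 7) (Fin 7) ℝ)), (mem_g2.1 X.2 t).fst⟩,
    (mem_g2.1 X.2 t).snd⟩

/-- The action of `G₂ ⊆ SO(7)` on `Cliff(7)`. -/
def g2Action : G2 →* (Cliff 7 →ₐ[ℝ] Cliff 7) := (rotationAction 7).comp G2.subtype

/-- The (quantum) comoment maps for the action of `G₂` on `Cliff(7)`. -/
abbrev G2ComomentMap : Type := ComomentMap (cliffGrading 7) g2Action g2Exp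

/-- The cubic element `∑_{i < j < k} ε(eᵢ, eⱼ, eₖ) xᵢ xⱼ xₖ` of `Cliff(7)`. -/
def cliffEpsilon : Cliff 7 :=
  ∑ i, ∑ j ∈ Finset.Ioi i, ∑ k ∈ Finset.Ioi j,
    octForm (Pi.single i 1) (Pi.single j 1) (Pi.single k 1) • (cliffGen i * cliffGen j * cliffGen k)

/-- The volume element `θ = x₁ x₂ ⋯ x₇` of `Cliff(7)`. -/
def cliffTheta : Cliff 7 := (List.ofFn fun i : Fin 7 => (cliffGen i : Cliff 7)).prod

end G2

end

/-! The element `E = 1 - θ ε` (`spinorProj`) carries the proof. Since `θ` is central with `θ² = 1`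
and `(θ ε)² = 7 - 6 θ ε`, the element `θ ε` has eigenvalues `-7` and `1`, so `e = E / 8` is an even
idempotent. It projects to the spinor `s` fixed by `G₂`. Over the centre `ℝ[θ]` the spinors have
basis `s, x₁ s, …, x₇ s`, the splitting `8 = 1 + 7` under `G₂`, so `Cliff(7)` is the algebra of `8 ×
8` matrices over `ℝ[θ]` and `e` is a matrix unit.

The spin lift of `𝔤₂` kills `s`, hence `E`. Conversely the sum of squares of the generators (a
Casimir element) is `6 E - 48 = -48 (1 - e)`. Hence the left ideal `⟨μ 𝔤₂⟩` is exactly the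
annihilator of `E` (`mem_g2Comoment_leftIdeal`), and the quotient is `A e`. Everything else is
idempotent algebra: endomorphisms of `A e` are given by `e A e`, which is `ℝ[θ] e` because `E x_k E
= 0` (`spinorProj_mul_mul_spinorProj`), and `ℝ[θ]` with `θ` odd is `Cliff(-1)`. The idempotent is
full, by `E - ∑ x_k E x_k = 8` (`spinorProj_sub_sum`), so `A e` and `e A` are inverse bimodules
(`isMoritaEquivalence_of_idempotent`).

Two comoment maps differ by even central elements, i.e. by scalars, and these vanish because `𝔤₂` is
perfect. An invariant element acts by one element of `ℝ[θ]` on `s` and by another on all the `x_k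
s`; these four real parameters are matched by `1, ε, θ ε, θ`.

The explicit identities are integral relations between words in the generators, and are decided by
evaluating a normal form. -/

/-! ### Morita equivalences from full idempotents -/

section Idempotent

variable {A B : Type} [Ring A] [Algebra ℝ A] [Ring B] [Algebra ℝ B]

/-- The right ideal `e A` of an idempotent `e`. -/
def idempotentRange (e : A) : Submodule ℝ A where
  carrier := {n | e * n = n}
  add_mem' {x y} hx hy := by
    change e * (x + y) = x + y
    rw [mul_add, hx, hy]
  zero_mem' := mul_zero e
  smul_mem' r x hx := by
    change e * (r • x) = r • x
    rw [mul_smul_comm, hx]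

/-- A central algebra map makes `e A` a left module. -/
abbrev idempotentRangeModule (e : A) (j : B →ₐ[ℝ] A) (hj : ∀ b a, j b * a = a * j b) :
    Module B (idempotentRange e) where
  smul b n := ⟨j b * n, by
    change e * (j b * (n : A)) = j b * n
    rw [← mul_assoc, ← hj, mul_assoc, n.2]⟩
  one_smul n := Subtype.ext (by change j 1 * (n : A) = n; rw [map_one, one_mul])
  mul_smul b c n := Subtype.ext (by
    change j (b * c) * (n : A) = j b * (j c * n); rw [map_mul, mul_assoc])
  smul_zero b := Subtype.ext (mul_zero _)
  smul_add b m n := Subtype.ext (mul_add _ _ _)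
  add_smul b c n := Subtype.ext (by
    change j (b + c) * (n : A) = j b * n + j c * n; rw [map_add, add_mul])
  zero_smul n := Subtype.ext (by change j 0 * (n : A) = 0; rw [map_zero, zero_mul])

variable {𝒜 : ZMod 2 → Submodule ℝ A} {ℬ : ZMod 2 → Submodule ℝ B}

theorem exists_even_add_odd [GradedAlgebra 𝒜] (a : A) : ∃ b ∈ 𝒜 0, ∃ c ∈ 𝒜 1, b + c = a := by
  classical
  refine Submodule.mem_sup.1 ?_
  rw [← DirectSum.sum_support_decompose 𝒜 a]
  have (i : ZMod 2) : 𝒜 i ≤ 𝒜 0 ⊔ 𝒜 1 := by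
    fin_cases i
    · exact le_sup_left
    · exact le_sup_right
  exact Submodule.sum_mem _ fun i _ => this i (SetLike.coe_mem _)

theorem idempotentRange_isScalarTower (e : A) (j : B →ₐ[ℝ] A) (hj : ∀ b a, j b * a = a * j b) :
    letI := idempotentRangeModule e j hj
    IsScalarTower ℝ B (idempotentRange e) :=
  letI := idempotentRangeModule e j hj
  ⟨fun r b n => Subtype.ext (by
    change j (r • b) * (n : A) = r • (j b * n); rw [map_smul, smul_mul_assoc])⟩

/-- The graded bimodule `e A`, where `B` acts from the left through a central algebra map. -/
def idempotentBimodule [GradedAlgebra 𝒜] (e : A) (he0 : e ∈ 𝒜 0)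
    (j : B →ₐ[ℝ] A) (hj : ∀ b a, j b * a = a * j b) (hjg : ∀ i, ∀ b ∈ ℬ i, j b ∈ 𝒜 i) :
    SuperBimodule ℬ 𝒜 where
  carrier := idempotentRange e
  moduleLeft := idempotentRangeModule e j hj
  isScalarTower := idempotentRange_isScalarTower e j hj
  right :=
    letI := idempotentRangeModule e j hj
    haveI := idempotentRange_isScalarTower e j hj
    { toFun := fun a => MulOpposite.op
        { toFun := fun n => ⟨n * a, by
            change e * ((n : A) * a) = n * a
            rw [← mul_assoc, n.2]⟩
          map_add' := fun m n => Subtype.ext (add_mul _ _ _)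
          map_smul' := fun b n => Subtype.ext (mul_assoc _ _ _) }
      map_one' := MulOpposite.unop_injective (LinearMap.ext fun n => Subtype.ext (mul_one _))
      map_mul' := fun a b =>
        MulOpposite.unop_injective (LinearMap.ext fun n => Subtype.ext (mul_assoc _ _ _).symm)
      map_zero' := MulOpposite.unop_injective (LinearMap.ext fun n => Subtype.ext (mul_zero _))
      map_add' := fun a b =>
        MulOpposite.unop_injective (LinearMap.ext fun n => Subtype.ext (mul_add _ _ _))
      commutes' := fun r =>
        MulOpposite.unop_injective (LinearMap.ext fun n => Subtype.ext (by
          change (n : A) * algebraMap ℝ A r = r • (n : A)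
          rw [← Algebra.commutes, Algebra.smul_def])) }
  grading i := (𝒜 i).comap (idempotentRange e).subtype
  isCompl := by
    constructor
    · rw [Submodule.disjoint_def]
      intro n h0 h1
      refine Subtype.ext ?_
      have := DirectSum.decompose_of_mem_same 𝒜 h0
      rw [DirectSum.decompose_of_mem_ne 𝒜 h1 (by decide)] at this
      exact this.symm
    · rw [codisjoint_iff, eq_top_iff]
      rintro n -
      obtain ⟨b, hb, c, hc, hbc⟩ := exists_even_add_odd (𝒜 := 𝒜) (n : A)
      have hn : e * (b + c) = b + c := hbc ▸ n.2
      have h0 : e * b ∈ 𝒜 0 := zero_add (0 : ZMod 2) ▸ SetLike.mul_mem_graded he0 hb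
      have h1 : e * c ∈ 𝒜 1 := zero_add (1 : ZMod 2) ▸ SetLike.mul_mem_graded he0 hc
      -- As `e` is even, the left side is even and the right side odd, so both vanish and `e` fixes
      -- each homogeneous component.
      have hd : e * b - b = c - e * c := by
        rw [mul_add] at hn
        rw [sub_eq_sub_iff_add_eq_add, hn, add_comm]
      have hz : e * b - b = 0 := by
        have := DirectSum.decompose_of_mem_same 𝒜 (sub_mem h0 hb)
        rw [hd, DirectSum.decompose_of_mem_ne 𝒜 (sub_mem hc h1) (by decide), ← hd] at this
        exact this.symm
      have hb' : e * b = b := sub_eq_zero.1 hz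
      have hc' : e * c = c := by rw [hz] at hd; exact (sub_eq_zero.1 hd.symm).symm
      exact Submodule.mem_sup.2 ⟨⟨b, hb'⟩, hb, ⟨c, hc'⟩, hc, Subtype.ext hbc⟩
  smul_mem i k b hb n hn :=
    show j b * (n : A) ∈ 𝒜 (i + k) from SetLike.mul_mem_graded (hjg i b hb) hn
  right_mem i k a ha n hn :=
    show (n : A) * a ∈ 𝒜 (k + i) from
      SetLike.mul_mem_graded (show (n : A) ∈ 𝒜 k from hn) ha

namespace SuperBimodule

theorem tmul_right_tmul {C : Type} [Ring C] [Algebra ℝ C] {𝒞 : ZMod 2 → Submodule ℝ C}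
    (M : SuperBimodule 𝒜 ℬ) (N : SuperBimodule ℬ 𝒞) (m : M.carrier) (b : B) (n : N.carrier) :
    tmul M N ((M.right b).unop m) n = tmul M N m (b • n) :=
  (Submodule.Quotient.eq _).2 (Submodule.subset_span ⟨m, b, n, rfl⟩)

theorem tensor_induction {C : Type} [Ring C] [Algebra ℝ C] {𝒞 : ZMod 2 → Submodule ℝ C}
    {M : SuperBimodule 𝒜 ℬ} {N : SuperBimodule ℬ 𝒞} {V : Type} [AddCommGroup V] [Module ℝ V]
    {f g : Tensor M N →ₗ[ℝ] V} (h : ∀ m n, f (tmul M N m n) = g (tmul M N m n)) : f = g := by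
  apply Submodule.linearMap_qext
  apply TensorProduct.ext'
  exact h

/-- A graded bimodule `M ≅ A e` for a full idempotent `e` is a Morita equivalence when `B` is
identified with `e A e` through a central algebra map. -/
theorem isMoritaEquivalence_of_idempotent [GradedAlgebra 𝒜] (M : SuperBimodule 𝒜 ℬ)
    {e : A} (he : e * e = e) (he0 : e ∈ 𝒜 0)
    {κ : Type} [Fintype κ] {u v : κ → A} (huv : ∑ k, u k * e * v k = 1)
    (j : B →ₐ[ℝ] A) (hj : ∀ b a, j b * a = a * j b) (hjg : ∀ i, ∀ b ∈ ℬ i, j b ∈ 𝒜 i)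
    (hcorner : ∀ i, ∀ x ∈ 𝒜 i, ∃ b ∈ ℬ i, e * x * e = j b * e)
    (hinj : ∀ b, j b * e = 0 → b = 0)
    (m₀ : M.carrier) (hgen : ∀ i, ∀ m ∈ M.grading i, ∃ a ∈ 𝒜 i, m = a • m₀)
    (hann : ∀ a : A, a • m₀ = 0 ↔ a * e = 0) (hright : ∀ b, (M.right b).unop m₀ = j b • m₀) :
    M.IsMoritaEquivalence := by
  let N : SuperBimodule ℬ 𝒜 := idempotentBimodule e he0 j hj hjg
  have hsurj : Function.Surjective (LinearMap.toSpanSingleton A M.carrier m₀) := by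
    intro m
    obtain ⟨x, hx, y, hy, rfl⟩ := Submodule.mem_sup.1
      (M.isCompl.sup_eq_top ▸ Submodule.mem_top : m ∈ M.grading 0 ⊔ M.grading 1)
    obtain ⟨a, -, rfl⟩ := hgen 0 x hx
    obtain ⟨b, -, rfl⟩ := hgen 1 y hy
    exact ⟨a + b, add_smul _ _ _⟩
  choose lft hlft using hsurj
  replace hlft (m : M.carrier) : lft m • m₀ = m := hlft m
  have hwd {a b : A} (h : a • m₀ = b • m₀) : a * e = b * e := by
    rw [← sub_eq_zero, ← sub_mul, ← hann, sub_smul, h, sub_self]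
  have hem : e • m₀ = m₀ := by
    rw [← sub_eq_zero, ← neg_sub, neg_eq_zero]
    have := (hann (1 - e)).2 (by rw [sub_mul, one_mul, he, sub_self])
    rwa [sub_smul, one_smul] at this
  -- The isomorphism `M ≅ A e`, `a m₀ ↦ a e`. It does not depend on the choice of `a`, since `m₀`
  -- and `e` have the same annihilator.
  let F : M.carrier →ₗ[A] A :=
    { toFun := fun m => lft m * e
      map_add' := fun m n => by
        rw [← add_mul]
        exact hwd (by rw [add_smul, hlft, hlft, hlft])
      map_smul' := fun a m => by
        rw [RingHom.id_apply, smul_eq_mul, ← mul_assoc]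
        exact hwd (by rw [mul_smul, hlft, hlft]) }
  have hF (a : A) : F (a • m₀) = a * e := hwd (hlft _)
  have hFm (m : M.carrier) : F m • m₀ = m := by
    change (lft m * e) • m₀ = m
    rw [mul_smul, hem, hlft]
  have hFe (m : M.carrier) : F m * e = F m := by
    change lft m * e * e = lft m * e
    rw [mul_assoc, he]
  have hFr (m : M.carrier) (b : B) : F ((M.right b).unop m) = F m * j b := by
    conv_lhs => rw [← hFm m, map_smul, hright, ← mul_smul, hF]
    rw [mul_assoc, hj, ← mul_assoc, hFe]
  have hFg (i) (m) (hm : m ∈ M.grading i) : F m ∈ 𝒜 i := by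
    obtain ⟨a, ha, rfl⟩ := hgen i m hm
    rw [hF]
    exact add_zero i ▸ SetLike.mul_mem_graded ha he0
  have hcorner' (x : A) : ∃ b, e * x * e = j b * e := by
    obtain ⟨y, hy, z, hz, rfl⟩ := exists_even_add_odd (𝒜 := 𝒜) x
    obtain ⟨b, -, hb⟩ := hcorner 0 y hy
    obtain ⟨c, -, hc⟩ := hcorner 1 z hz
    exact ⟨b + c, by rw [mul_add, add_mul, hb, hc, map_add, add_mul]⟩
  have hjinj {b c : B} (h : j b * e = j c * e) : b = c := by
    rw [← sub_eq_zero]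
    exact hinj _ (by rw [map_sub, sub_mul, h, sub_self])
  choose cor hcor using hcorner'
  let nmk (a : A) : N.carrier := (⟨e * a, show e * (e * a) = e * a by rw [← mul_assoc, he]⟩ :
    idempotentRange e)
  let val : N.carrier →ₗ[ℝ] A := (idempotentRange e).subtype
  have hval (n : N.carrier) : e * val n = val n := n.2
  have hvmk (a : A) : val (nmk a) = e * a := rfl
  have hvs (b : B) (n : N.carrier) : val (b • n) = j b * val n := rfl
  have hvr (a : A) (n : N.carrier) : val ((N.right a).unop n) = val n * a := rfl
  have hvinj {m n : N.carrier} (h : val m = val n) : m = n := Subtype.ext h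
  refine ⟨N, ?_, ?_⟩
  · let f : Tensor M N →ₗ[ℝ] A := (balancing M N).liftQ
      (TensorProduct.lift ((LinearMap.mul ℝ A).compl₁₂ (F.restrictScalars ℝ) val)) (by
        rw [balancing, Submodule.span_le]
        rintro _ ⟨m, b, n, rfl⟩
        change _ = _
        rw [map_sub, TensorProduct.lift.tmul, TensorProduct.lift.tmul]
        change F ((M.right b).unop m) * val n - F m * val (b • n) = 0
        rw [hFr, hvs, mul_assoc, sub_self])
    have hf (m n) : f (tmul M N m n) = F m * val n := rfl
    -- Fullness supplies the inverse of the multiplication `A e ⊗ e A → A`: it is `a ↦ ∑ a u_k e ⊗ e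
    -- v_k`, with `m₀` in the role of `e`.
    let g : A →ₗ[ℝ] Tensor M N := ∑ k,
      (balancing M N).mkQ ∘ₗ (TensorProduct.mk ℝ M.carrier N.carrier).flip (nmk (v k)) ∘ₗ
        (LinearMap.toSpanSingleton A M.carrier m₀).restrictScalars ℝ ∘ₗ
          LinearMap.mulRight ℝ (u k)
    have hg (a : A) : g a = ∑ k, tmul M N ((a * u k) • m₀) (nmk (v k)) := by
      simp only [g, LinearMap.sum_apply]
      rfl
    refine ⟨LinearEquiv.ofLinearMap f g ?_ ?_, ?_, ?_, ?_⟩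
    · ext a
      rw [LinearMap.comp_apply, hg, map_sum, LinearMap.id_apply]
      simp only [hf, hF, hvmk]
      conv_rhs => rw [← mul_one a, ← huv, Finset.mul_sum]
      refine Finset.sum_congr rfl fun k _ => ?_
      rw [← mul_assoc, mul_assoc (a * u k), he]
      simp only [mul_assoc]
    · apply tensor_induction
      intro m n
      rw [LinearMap.comp_apply, hf, hg, LinearMap.id_apply]
      -- The factor `n u_k e` lies in the corner `e A e = j(B) e`, so it comes from `B` and can
      -- cross the tensor sign.
      have h1 (k : κ) : (F m * val n * u k) • m₀ = (M.right (cor (val n * u k))).unop m := by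
        conv_lhs => rw [← hem, ← mul_smul]
        conv_rhs => rw [← hFm m, map_smul, hright, ← hem, ← mul_smul, ← mul_smul]
        congr 1
        rw [mul_assoc (F m) (j _), ← hcor]
        simp only [← mul_assoc, hFe]
      simp only [h1, tmul_right_tmul]
      have h2 : n = ∑ k, cor (val n * u k) • nmk (v k) := by
        apply hvinj
        rw [map_sum]
        simp only [hvs, hvmk, ← mul_assoc, ← hcor, hval]
        conv_lhs => rw [← mul_one (val n), ← huv, Finset.mul_sum]
        simp only [mul_assoc]
      conv_rhs => rw [h2]
      simp only [tmul, TensorProduct.tmul_sum, map_sum]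
    · intro a m n
      change F (a • m) * val n = a * (F m * val n)
      rw [map_smul, smul_eq_mul, mul_assoc]
    · intro a m n
      change F m * val ((N.right a).unop n) = F m * val n * a
      rw [hvr, mul_assoc]
    · intro i k m hm n hn
      exact SetLike.mul_mem_graded (hFg i m hm) hn
  · have hne (n : N.carrier) (m : M.carrier) : val n * F m = j (cor (val n * F m)) * e := by
      rw [← hcor, ← mul_assoc, hval, mul_assoc, hFe]
    -- The product of `e A` and `A e` lands in `e A e`; injectivity of `b ↦ j b * e` makes the
    -- chosen preimage in `B` bilinear.
    let c : N.carrier →ₗ[ℝ] M.carrier →ₗ[ℝ] B := LinearMap.mk₂ ℝ (fun n m => cor (val n * F m))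
      (fun n n' m => hjinj (by
        rw [← hne, map_add j, add_mul, ← hne, ← hne, map_add, add_mul]))
      (fun r n m => hjinj (by
        rw [← hne, map_smul j, smul_mul_assoc, ← hne, map_smul, smul_mul_assoc]))
      (fun n m m' => hjinj (by
        rw [← hne, map_add j, add_mul, ← hne, ← hne, map_add, mul_add]))
      (fun r n m => hjinj (by
        rw [← hne, map_smul j, smul_mul_assoc, ← hne, ← mul_smul_comm]
        congr 1
        exact (F.restrictScalars ℝ).map_smul r m))
    let f : Tensor N M →ₗ[ℝ] B := (balancing N M).liftQ (TensorProduct.lift c) (by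
        rw [balancing, Submodule.span_le]
        rintro _ ⟨n, a, m, rfl⟩
        change _ = _
        rw [map_sub, TensorProduct.lift.tmul, TensorProduct.lift.tmul]
        change cor (val ((N.right a).unop n) * F m) - cor (val n * F (a • m)) = 0
        rw [hvr, map_smul, smul_eq_mul, mul_assoc, sub_self])
    have hf (n m) : j (f (tmul N M n m)) * e = val n * F m := (hne n m).symm
    let g : B →ₗ[ℝ] Tensor N M :=
      (balancing N M).mkQ ∘ₗ (TensorProduct.mk ℝ N.carrier M.carrier).flip m₀ ∘ₗ
        LinearMap.toSpanSingleton B N.carrier (nmk 1) |>.restrictScalars ℝ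
    have hg (b : B) : g b = tmul N M (b • nmk 1) m₀ := rfl
    refine ⟨LinearEquiv.ofLinearMap f g ?_ ?_, ?_, ?_, ?_⟩
    · ext b
      apply hjinj
      rw [LinearMap.comp_apply, hg, hf, LinearMap.id_apply, hvs, hvmk, mul_one, mul_assoc,
        ← smul_eq_mul e, ← map_smul, hem]
      conv_lhs => rw [← hem, hF, he]
    · apply tensor_induction
      intro n m
      rw [LinearMap.comp_apply, hg, LinearMap.id_apply]
      -- The element `n F(m)` of the corner acts on `e` from the left as `F(m)` acts on `n` from the
      -- right; then `F(m)` crosses the tensor sign and `F(m) m₀ = m`.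
      have h1 : f (tmul N M n m) • nmk 1 = (N.right (F m)).unop n := by
        apply hvinj
        rw [hvs, hvmk, mul_one, hf, hvr]
      rw [h1, tmul_right_tmul, hFm]
    · intro b n m
      apply hjinj
      change j (f (tmul N M (b • n) m)) * e = j (b * f (tmul N M n m)) * e
      rw [hf, map_mul, mul_assoc, hf, hvs, mul_assoc]
    · intro b n m
      apply hjinj
      change j (f (tmul N M n ((M.right b).unop m))) * e = j (f (tmul N M n m) * b) * e
      rw [hf, hFr, map_mul, mul_assoc (j _), hj b, ← mul_assoc (j _), hf, mul_assoc]
    · intro i k n hn m hm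
      change f (tmul N M n m) ∈ _
      obtain ⟨b, hb, hbe⟩ := hcorner (i + k) _ (SetLike.mul_mem_graded hn (hFg k m hm))
      convert hb using 1
      apply hjinj
      rw [hf, ← hbe]
      change _ = e * (val n * F m) * e
      rw [← mul_assoc, hval, mul_assoc, hFe]

end SuperBimodule

end Idempotent

/-! ### Computation with integral combinations of words in the generators -/

section Words

/-- Left multiplication of a sorted word by a generator, with the resulting sign. -/
def wordInsert (i : Fin 7) : List (Fin 7) → ℤ × List (Fin 7)
  | [] => (1, [i])
  | j :: l => if i < j then (1, i :: j :: l) else if i = j then (-1, l) else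
      (-(wordInsert i l).1, j :: (wordInsert i l).2)

/-- Formal integral combinations of words. -/
abbrev WordSum : Type := List (ℤ × List (Fin 7))

namespace WordSum

/-- Left multiplication by a generator. -/
def genMul (i : Fin 7) (f : WordSum) : WordSum :=
  f.map fun t => (t.1 * (wordInsert i t.2).1, (wordInsert i t.2).2)

/-- Multiplication by an integer. -/
def scale (c : ℤ) (f : WordSum) : WordSum := f.map fun t => (c * t.1, t.2)

/-- The product of formal combinations. -/
def times (f g : WordSum) : WordSum := f.flatMap fun t => scale t.1 (t.2.foldr genMul g)

/-- Add a term, collecting coefficients. -/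
def insertTerm (t : ℤ × List (Fin 7)) : WordSum → WordSum
  | [] => [t]
  | s :: f => if s.2 = t.2 then (s.1 + t.1, s.2) :: f else s :: insertTerm t f

/-- Collect the coefficients of equal words. -/
def collect (f : WordSum) : WordSum := f.foldr insertTerm []

/-- The test that all coefficients cancel. -/
def cancels (f : WordSum) : Bool := (collect f).all fun t => t.1 == 0

/-- The element of `Cliff(7)` given by a formal combination. -/
noncomputable def eval (f : WordSum) : Cliff 7 :=
  (f.map fun t => t.1 • (t.2.map cliffGen).prod).sum

end WordSum

theorem cliffGen_mul_self {n : ℕ} (i : Fin n) : (cliffGen i * cliffGen i : Cliff n) = -1 := by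
  rw [cliffGen, CliffordAlgebra.ι_sq_scalar]
  simp [QuadraticMap.weightedSumSquares_apply, Pi.single_apply]

theorem cliffGen_mul_add_swap {n : ℕ} (i j : Fin n) :
    (cliffGen i * cliffGen j + cliffGen j * cliffGen i : Cliff n) = if i = j then -2 else 0 := by
  split_ifs with h
  · subst h
    rw [cliffGen_mul_self]
    norm_num
  · rw [cliffGen, cliffGen, CliffordAlgebra.ι_mul_ι_add_swap, QuadraticMap.polar]
    simp only [QuadraticMap.weightedSumSquares_apply, Pi.add_apply, Pi.single_apply]
    rw [← Finset.sum_sub_distrib, ← Finset.sum_sub_distrib, Finset.sum_eq_zero, map_zero]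
    intro k _
    by_cases h1 : k = i
    · subst h1; simp [h]
    · simp [h1]

/-- Valid for unsorted words too: a generator only passes a letter different from itself. Sortedness
matters only for recognizing equal words. -/
theorem cliffGen_mul_word (i : Fin 7) (l : List (Fin 7)) :
    (cliffGen i * (l.map cliffGen).prod : Cliff 7) =
      (wordInsert i l).1 • ((wordInsert i l).2.map cliffGen).prod := by
  induction l with
  | nil => simp [wordInsert]
  | cons j l ih =>
    have hs := cliffGen_mul_add_swap i j
    unfold wordInsert
    split_ifs with h1 h2
    · simp
    · subst h2
      simp [← mul_assoc, cliffGen_mul_self]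
    · rw [if_neg h2] at hs
      simp only [List.map_cons, List.prod_cons, neg_smul]
      rw [← mul_assoc, eq_neg_of_add_eq_zero_left hs, neg_mul, mul_assoc, ih, mul_smul_comm]

namespace WordSum

theorem eval_cons (t : ℤ × List (Fin 7)) (f : WordSum) :
    eval (t :: f) = t.1 • (t.2.map cliffGen).prod + eval f := by
  simp [eval]

theorem eval_append (f g : WordSum) : eval (f ++ g) = eval f + eval g := by
  simp [eval]

theorem eval_scale (c : ℤ) (f : WordSum) : eval (scale c f) = c • eval f := by
  induction f with
  | nil => simp [scale, eval]
  | cons t f ih =>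
    rw [eval_cons, smul_add, ← ih, scale, List.map_cons, eval_cons, mul_smul]
    rfl

theorem eval_genMul (i : Fin 7) (f : WordSum) : eval (genMul i f) = cliffGen i * eval f := by
  induction f with
  | nil => simp [genMul, eval]
  | cons t f ih =>
    rw [eval_cons, mul_add, ← ih, genMul, List.map_cons, eval_cons, mul_smul_comm,
      cliffGen_mul_word, mul_smul]
    rfl

theorem eval_times (f g : WordSum) : eval (times f g) = eval f * eval g := by
  induction f with
  | nil => simp [times, eval]
  | cons t f ih =>
    rw [eval_cons, add_mul, ← ih, times, List.flatMap_cons, eval_append, eval_scale, smul_mul_assoc]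
    congr 2
    generalize t.2 = l
    induction l with
    | nil => simp
    | cons i l ih => rw [List.foldr_cons, eval_genMul, ih, List.map_cons, List.prod_cons, mul_assoc]

theorem eval_insertTerm (t : ℤ × List (Fin 7)) (f : WordSum) :
    eval (insertTerm t f) = t.1 • (t.2.map cliffGen).prod + eval f := by
  induction f with
  | nil => exact eval_cons _ _
  | cons s f ih =>
    unfold insertTerm
    split_ifs with h
    · rw [eval_cons, eval_cons, ← h, add_smul]
      abel
    · rw [eval_cons, eval_cons, ih]
      abel

theorem eval_collect (f : WordSum) : eval (collect f) = eval f := by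
  induction f with
  | nil => rfl
  | cons t f ih => rw [collect, List.foldr_cons, eval_insertTerm, eval_cons]; exact congrArg _ ih

theorem eval_eq_zero {f : WordSum} (h : cancels f = true) : eval f = 0 := by
  rw [← eval_collect]
  unfold cancels at h
  generalize collect f = g at h
  induction g with
  | nil => rfl
  | cons t g ih =>
    simp only [List.all_cons, Bool.and_eq_true, beq_iff_eq] at h
    rw [eval_cons, h.1, zero_smul, zero_add, ih h.2]

/-- The bridge for all explicit identities below: a relation in `Cliff(7)` becomes a closed Boolean
computation. Only this direction is needed, so independence of the sorted words plays no role. -/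
theorem eval_eq_of_cancels {f g : WordSum} (h : cancels (f ++ scale (-1) g) = true) :
    eval f = eval g := by
  have := eval_eq_zero h
  rwa [eval_append, eval_scale, neg_one_smul, add_neg_eq_zero] at this

/-- A generator. -/
def gen (i : Fin 7) : WordSum := [(1, [i])]

/-- The unit. -/
def one : WordSum := [(1, [])]

/-- The volume element. -/
def theta : WordSum := [(1, [0, 1, 2, 3, 4, 5, 6])]

/-- The cubic element. -/
def epsilon : WordSum :=
  [(1, [0, 1, 2]), (1, [0, 3, 4]), (1, [0, 5, 6]), (1, [1, 3, 5]), (-1, [1, 4, 6]),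
    (-1, [2, 3, 6]), (-1, [2, 4, 5])]

/-- Eight times the idempotent that projects to the invariant spinor. -/
def proj : WordSum := one ++ scale (-1) (times theta epsilon)

theorem eval_gen (i : Fin 7) : eval (gen i) = cliffGen i := by simp [eval, gen]

theorem eval_one : eval one = 1 := by simp [eval, one]

theorem eval_theta : eval theta = cliffTheta := by
  simp [eval, theta, cliffTheta]

end WordSum

/-- The structure constants `ε(eᵢ, eⱼ, eₖ)` of the octonions. -/
def octCoeff (i j k : Fin 7) : ℤ :=
  (([(0, 1, 2), (0, 3, 4), (0, 5, 6), (1, 3, 5), (1, 6, 4), (2, 6, 3), (2, 5, 4)] :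
    List (Fin 7 × Fin 7 × Fin 7)).map fun p =>
      let d (x y : Fin 7) : ℤ := if x = y then 1 else 0
      d p.1 i * (d p.2.1 j * d p.2.2 k - d p.2.2 j * d p.2.1 k)
        - d p.2.1 i * (d p.1 j * d p.2.2 k - d p.2.2 j * d p.1 k)
        + d p.2.2 i * (d p.1 j * d p.2.1 k - d p.2.1 j * d p.1 k)).sum

theorem octForm_single (i j k : Fin 7) :
    octForm (Pi.single i 1) (Pi.single j 1) (Pi.single k 1) = octCoeff i j k := by
  have h (a b c : Fin 7 → ℝ) : octForm a b c =
      (([(0, 1, 2), (0, 3, 4), (0, 5, 6), (1, 3, 5), (1, 6, 4), (2, 6, 3), (2, 5, 4)] :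
        List (Fin 7 × Fin 7 × Fin 7)).map fun p =>
          a p.1 * (b p.2.1 * c p.2.2 - b p.2.2 * c p.2.1)
            - a p.2.1 * (b p.1 * c p.2.2 - b p.2.2 * c p.1)
            + a p.2.2 * (b p.1 * c p.2.1 - b p.2.1 * c p.1)).sum := by
    simp [octForm_eq, Matrix.det_fin_three]
    ring
  rw [h, octCoeff]
  simp only [Pi.single_apply, List.map_cons, List.map_nil, List.sum_cons, List.sum_nil]
  push_cast
  rfl

namespace WordSum

theorem eval_flatMap_finRange (F : Fin 7 → WordSum) :
    eval ((List.finRange 7).flatMap F) = ∑ i, eval (F i) := by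
  rw [Fin.sum_univ_def]
  induction List.finRange 7 with
  | nil => rfl
  | cons i l ih => rw [List.flatMap_cons, eval_append, ih, List.map_cons, List.sum_cons]

/-- The three signs `-1` in `epsilon` come from sorting `x₂x₇x₅`, `x₃x₇x₄` and `x₃x₆x₅`. -/
theorem eval_epsilon : eval epsilon = cliffEpsilon := by
  have h : eval epsilon = eval ((List.finRange 7).flatMap fun i => (List.finRange 7).flatMap fun j =>
      if i < j then (List.finRange 7).flatMap fun k =>
        if j < k then [(octCoeff i j k, [i, j, k])] else [] else []) :=
    eval_eq_of_cancels (by decide +kernel)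
  rw [h, cliffEpsilon, eval_flatMap_finRange]
  refine Finset.sum_congr rfl fun i _ => ?_
  have hIoi (i : Fin 7) : Finset.Ioi i = Finset.univ.filter (i < ·) := by ext; simp
  rw [eval_flatMap_finRange, hIoi, Finset.sum_filter]
  refine Finset.sum_congr rfl fun j _ => ?_
  split_ifs
  · rw [eval_flatMap_finRange, hIoi, Finset.sum_filter]
    refine Finset.sum_congr rfl fun k _ => ?_
    split_ifs
    · rw [octForm_single, Int.cast_smul_eq_zsmul]
      simp [eval, mul_assoc]
    · rfl
  · rfl

end WordSum

/-- Three pairs `(i, j)` with `eᵢ eⱼ = eₖ` in the octonions. -/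
def octLine (k : Fin 7) (a : Fin 3) : Fin 7 × Fin 7 :=
  (![![(1, 2), (3, 4), (5, 6)], ![(2, 0), (3, 5), (6, 4)], ![(0, 1), (6, 3), (5, 4)],
    ![(4, 0), (5, 1), (2, 6)], ![(0, 3), (1, 6), (2, 5)], ![(6, 0), (1, 3), (4, 2)],
    ![(0, 5), (4, 1), (3, 2)]] : Fin 7 → Fin 3 → Fin 7 × Fin 7) k a

/-- Eight times the idempotent of `Cliff(7)` that projects to the invariant spinor. -/
noncomputable def spinorProj : Cliff 7 := 1 - cliffTheta * cliffEpsilon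

namespace WordSum

theorem eval_proj : eval proj = spinorProj := by
  rw [proj, eval_append, eval_scale, eval_times, eval_one, eval_theta, eval_epsilon, spinorProj,
    neg_one_smul, sub_eq_add_neg]

end WordSum

open WordSum

/-! ### Explicit identities for the volume element, the cubic and the spinor projection -/

theorem cliffTheta_mul_self : cliffTheta * cliffTheta = 1 := by
  have h : eval (times theta theta) = eval one := eval_eq_of_cancels (by decide +kernel)
  simpa only [eval_times, eval_theta, eval_one] using h

theorem cliffTheta_mul_cliffGen (i : Fin 7) : cliffTheta * cliffGen i = cliffGen i * cliffTheta := by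
  have h : ∀ i, cancels (times theta (gen i) ++ scale (-1) (times (gen i) theta)) = true := by
    decide +kernel
  simpa only [eval_times, eval_theta, eval_gen] using eval_eq_of_cancels (h i)

/-- This is `(θ ε + 7)(θ ε - 1) = 0`. It makes `1 - θ ε` eight times a projection to the eigenvalue
`-7`. -/
theorem cliffTheta_mul_cliffEpsilon_sq :
    cliffTheta * cliffEpsilon * (cliffTheta * cliffEpsilon) =
      7 - 6 * (cliffTheta * cliffEpsilon) := by
  have h : eval (times (times theta epsilon) (times theta epsilon)) =
      eval (scale 7 one ++ scale (-6) (times theta epsilon)) :=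
    eval_eq_of_cancels (by decide +kernel)
  simp only [eval_times, eval_theta, eval_epsilon, eval_append, eval_scale, eval_one] at h
  rw [h]
  simp [sub_eq_add_neg]

theorem spinorProj_mul_self : spinorProj * spinorProj = (8 : ℝ) • spinorProj := by
  have h : eval (times proj proj) = eval (scale 8 proj) := eval_eq_of_cancels (by decide +kernel)
  rw [eval_times, eval_scale, eval_proj, ← Int.cast_smul_eq_zsmul ℝ] at h
  exact_mod_cast h

/-- The spinors `x_k s` are orthogonal to the invariant spinor `s`. -/
theorem spinorProj_mul_cliffGen_mul_spinorProj (i : Fin 7) :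
    spinorProj * cliffGen i * spinorProj = 0 := by
  have h : ∀ i, cancels (times (times proj (gen i)) proj) = true := by decide +kernel
  simpa only [eval_times, eval_proj, eval_gen] using eval_eq_zero (h i)

/-- A resolution of the identity: `x_k⁻¹ = -x_k`, so `-x_k E x_k` is eight times the projection to
`x_k s`, and `s` and the `x_k s` together are a basis over `ℝ[θ]`. -/
theorem spinorProj_sub_sum :
    spinorProj - ∑ i, cliffGen i * spinorProj * cliffGen i = (8 : ℝ) • 1 := by
  have h : eval (proj ++ scale (-1) ((List.finRange 7).flatMap fun i =>
      times (times (gen i) proj) (gen i))) = eval (scale 8 one) :=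
    eval_eq_of_cancels (by decide +kernel)
  simp only [eval_append, eval_scale, eval_proj, eval_flatMap_finRange, eval_times, eval_gen,
    eval_one] at h
  rw [neg_one_smul, ← sub_eq_add_neg, ← Int.cast_smul_eq_zsmul ℝ] at h
  exact_mod_cast h

/-- On the invariant spinor, Clifford multiplication reproduces octonion multiplication up to `θ`.
The right side is the same for the three pairs of each `k`, and this is why the spin lift of `𝔤₂`
annihilates `E`. -/
theorem octLine_mul_spinorProj (k : Fin 7) (a : Fin 3) :
    cliffGen (octLine k a).1 * cliffGen (octLine k a).2 * spinorProj =
      cliffGen k * cliffTheta * spinorProj := by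
  have h : ∀ k a, cancels (times (times (gen (octLine k a).1) (gen (octLine k a).2)) proj ++
    scale (-1) (times (times (gen k) theta) proj)) = true := by decide +kernel
  simpa only [eval_times, eval_proj, eval_gen, eval_theta] using eval_eq_of_cancels (h k a)

theorem cliffEpsilon_mul_spinorProj :
    cliffEpsilon * spinorProj = (-7 : ℝ) • (cliffTheta * spinorProj) := by
  have h : eval (times epsilon proj) = eval (scale (-7) (times theta proj)) :=
    eval_eq_of_cancels (by decide +kernel)
  simp only [eval_times, eval_proj, eval_theta, eval_epsilon, eval_scale] at h
  rw [h, ← Int.cast_smul_eq_zsmul ℝ]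
  norm_num

theorem cliffEpsilon_mul_cliffGen_mul_spinorProj (k : Fin 7) :
    cliffEpsilon * (cliffGen k * spinorProj) = cliffTheta * (cliffGen k * spinorProj) := by
  have h : ∀ k, cancels (times epsilon (times (gen k) proj) ++
      scale (-1) (times theta (times (gen k) proj))) = true := by decide +kernel
  simpa only [eval_times, eval_proj, eval_theta, eval_epsilon, eval_gen] using
    eval_eq_of_cancels (h k)

/-- The form and the product of distinct generators are both alternating, so every increasing triple
occurs six times. The sum over all triples is the version suited to a change of basis. -/
theorem six_smul_cliffEpsilon : (6 : ℝ) • cliffEpsilon =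
    ∑ i, ∑ j, ∑ k, octForm (Pi.single i 1) (Pi.single j 1) (Pi.single k 1) •
      (cliffGen i * cliffGen j * cliffGen k) := by
  have h : eval (scale 6 epsilon) = eval ((List.finRange 7).flatMap fun i =>
      (List.finRange 7).flatMap fun j => (List.finRange 7).flatMap fun k =>
        scale (octCoeff i j k) (times (times (gen i) (gen j)) (gen k))) :=
    eval_eq_of_cancels (by decide +kernel)
  simp only [eval_scale, eval_epsilon, eval_flatMap_finRange, eval_times, eval_gen] at h
  simp only [octForm_single, Int.cast_smul_eq_zsmul]
  rw [← h, ← Int.cast_smul_eq_zsmul ℝ, Int.cast_ofNat]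

/-- The spin lift, up to a factor, of a generator of `𝔤₂`. -/
noncomputable def spinGen (k : Fin 7) (a : Fin 3) : Cliff 7 :=
  cliffGen (octLine k a).1 * cliffGen (octLine k a).2 -
    cliffGen (octLine k (a + 1)).1 * cliffGen (octLine k (a + 1)).2

/-- The formal combination of words for `spinGen`. -/
def WordSum.spin (k : Fin 7) (a : Fin 3) : WordSum :=
  times (gen (octLine k a).1) (gen (octLine k a).2) ++
    scale (-1) (times (gen (octLine k (a + 1)).1) (gen (octLine k (a + 1)).2))

theorem WordSum.eval_spin (k : Fin 7) (a : Fin 3) : eval (spin k a) = spinGen k a := by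
  simp only [spin, eval_append, eval_scale, eval_times, eval_gen, spinGen, neg_one_smul,
    sub_eq_add_neg]

theorem spinGen_mul_spinorProj (k : Fin 7) (a : Fin 3) : spinGen k a * spinorProj = 0 := by
  rw [spinGen, sub_mul, octLine_mul_spinorProj, octLine_mul_spinorProj, sub_self]

/-- A Casimir element of `𝔤₂`: it is `0` on the invariant spinor and `-48` on the seven-dimensional
part. -/
theorem sum_spinGen_mul_self :
    ∑ k, ∑ a, spinGen k a * spinGen k a = (6 : ℝ) • spinorProj - (48 : ℝ) • 1 := by
  have h : eval ((List.finRange 7).flatMap fun k => times (spin k 0) (spin k 0) ++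
      (times (spin k 1) (spin k 1) ++ times (spin k 2) (spin k 2))) =
      eval (scale 6 proj ++ scale (-48) one) := eval_eq_of_cancels (by decide +kernel)
  simp only [eval_append, eval_scale, eval_proj, eval_flatMap_finRange, eval_times, eval_spin,
    eval_one] at h
  rw [← Int.cast_smul_eq_zsmul ℝ, ← Int.cast_smul_eq_zsmul ℝ, Int.cast_neg, neg_smul,
    ← sub_eq_add_neg] at h
  simp only [Fin.sum_univ_three, add_assoc]
  exact_mod_cast h

/-- The three elements `spinGen 0 a` kill both `s` and `x₁ s`, and their squares sum to `-8` on the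
other `x_k s`. Hence the projection to `x₁ s` is expressed by `E` and spin lifts of `𝔤₂`, and
commutes with every invariant. -/
theorem cliffGen_zero_mul_spinorProj_mul :
    cliffGen 0 * spinorProj * cliffGen 0 =
      spinorProj - (8 : ℝ) • 1 - ∑ a, spinGen 0 a * spinGen 0 a := by
  have h : eval (times (times (gen 0) proj) (gen 0)) =
      eval (proj ++ (scale (-8) one ++ scale (-1) (times (spin 0 0) (spin 0 0) ++
      (times (spin 0 1) (spin 0 1) ++ times (spin 0 2) (spin 0 2))))) :=
    eval_eq_of_cancels (by decide +kernel)
  simp only [eval_append, eval_scale, eval_proj, eval_times, eval_spin, eval_gen,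
    eval_one] at h
  rw [← Int.cast_smul_eq_zsmul ℝ, ← Int.cast_smul_eq_zsmul ℝ] at h
  rw [Fin.sum_univ_three, h]
  push_cast
  module

/-- The algebra `𝔤₂` acts transitively on the coordinate lines. -/
theorem exists_spinGen_mul_cliffGen_zero (j : Fin 7) (hj : j ≠ 0) :
    ∃ k a, spinGen k a * (cliffGen 0 * spinorProj) = (2 : ℝ) • (cliffGen j * spinorProj) := by
  have h : ∀ j : Fin 7, j ≠ 0 → ∃ k a, cancels (times (spin k a) (times (gen 0) proj) ++
      scale (-1) (scale 2 (times (gen j) proj))) = true := by decide +kernel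
  obtain ⟨k, a, h⟩ := h j hj
  refine ⟨k, a, ?_⟩
  have := eval_eq_of_cancels h
  simp only [eval_scale, eval_proj, eval_times, eval_spin, eval_gen] at this
  rw [this, ← Int.cast_smul_eq_zsmul ℝ, Int.cast_ofNat]

end Words

/-! ### The corner of the spinor projection -/

section Spinor

theorem submodule_eq_top_of_cliffGen_mul {n : ℕ} {P : Submodule ℝ (Cliff n)} (h1 : 1 ∈ P)
    (h : ∀ i, ∀ x ∈ P, cliffGen i * x ∈ P) : P = ⊤ := by
  rw [eq_top_iff]
  rintro x -
  induction x using CliffordAlgebra.left_induction with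
  | algebraMap r => rw [Algebra.algebraMap_eq_smul_one]; exact P.smul_mem r h1
  | add x y hx hy => exact P.add_mem hx hy
  | ι_mul x m hx =>
    rw [← Finset.univ_sum_single m, map_sum, Finset.sum_mul]
    refine P.sum_mem fun i _ => ?_
    have : Pi.single i (m i) = m i • (Pi.single i 1 : Fin n → ℝ) := by
      rw [← Pi.single_smul, smul_eq_mul, mul_one]
    rw [this, map_smul, smul_mul_assoc]
    exact P.smul_mem _ (h i x hx)

theorem commutes_of_cliffGen {n : ℕ} {z : Cliff n} (h : ∀ i, z * cliffGen i = cliffGen i * z)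
    (a : Cliff n) : z * a = a * z := by
  have := submodule_eq_top_of_cliffGen_mul
    (P := LinearMap.ker (LinearMap.mulLeft ℝ z - LinearMap.mulRight ℝ z)) (by simp)
    (fun i x hx => by
      simp only [LinearMap.mem_ker, LinearMap.sub_apply, LinearMap.mulLeft_apply,
        LinearMap.mulRight_apply, sub_eq_zero] at hx ⊢
      rw [← mul_assoc, h, mul_assoc, hx, mul_assoc])
  have ha : a ∈ (⊤ : Submodule ℝ (Cliff n)) := Submodule.mem_top
  rw [← this] at ha
  simpa [sub_eq_zero] using ha

theorem cliffTheta_mul (a : Cliff 7) : cliffTheta * a = a * cliffTheta :=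
  commutes_of_cliffGen cliffTheta_mul_cliffGen a

theorem spinorProj_ne_zero : spinorProj ≠ 0 := by
  intro h
  have := spinorProj_sub_sum
  simp only [h, mul_zero, zero_mul, Finset.sum_const_zero, sub_zero] at this
  have h1 : (1 : Cliff 7) = 0 := (smul_eq_zero.1 this.symm).resolve_left (by norm_num)
  exact one_ne_zero h1

theorem involute_cliffGen {n : ℕ} (i : Fin n) :
    CliffordAlgebra.involute (cliffGen i : Cliff n) = -cliffGen i :=
  CliffordAlgebra.involute_ι _

theorem involute_cliffTheta : CliffordAlgebra.involute cliffTheta = -cliffTheta := by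
  simp [cliffTheta, involute_cliffGen]

theorem involute_cliffEpsilon : CliffordAlgebra.involute cliffEpsilon = -cliffEpsilon := by
  simp [cliffEpsilon, involute_cliffGen]

theorem involute_spinorProj : CliffordAlgebra.involute spinorProj = spinorProj := by
  simp [spinorProj, involute_cliffTheta, involute_cliffEpsilon]

theorem mem_odd_of_involute {n : ℕ} {x : Cliff n} (h : CliffordAlgebra.involute x = -x) :
    x ∈ cliffGrading n 1 := by
  obtain ⟨b, hb, c, hc, rfl⟩ := exists_even_add_odd (𝒜 := cliffGrading n) x
  rw [map_add, CliffordAlgebra.involute_eq_of_mem_even hb,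
    CliffordAlgebra.involute_eq_of_mem_odd hc] at h
  have : (2 : ℝ) • b = 0 := by
    have h' : b + b = (b + -c) + (b + c) := by abel
    rw [two_smul, h', h, neg_add_cancel]
  rw [(smul_eq_zero.1 this).resolve_left two_ne_zero, zero_add]
  exact hc

theorem mem_even_of_involute {n : ℕ} {x : Cliff n} (h : CliffordAlgebra.involute x = x) :
    x ∈ cliffGrading n 0 := by
  obtain ⟨b, hb, c, hc, rfl⟩ := exists_even_add_odd (𝒜 := cliffGrading n) x
  rw [map_add, CliffordAlgebra.involute_eq_of_mem_even hb,
    CliffordAlgebra.involute_eq_of_mem_odd hc] at h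
  have : (2 : ℝ) • c = 0 := by
    have h' : c + c = (b + c) - (b + -c) := by abel
    rw [two_smul, h', h, sub_self]
  rw [(smul_eq_zero.1 this).resolve_left two_ne_zero, add_zero]
  exact hb

/-- `E` is even and `θ E` is odd, so the grading involution separates the two terms; `θ` is
invertible. -/
theorem cliffTheta_mul_spinorProj_cancel {r s : ℝ}
    (h : r • spinorProj + s • (cliffTheta * spinorProj) = 0) : r = 0 ∧ s = 0 := by
  have h2 := congrArg CliffordAlgebra.involute h
  simp only [map_add, map_smul, map_mul, involute_cliffTheta, involute_spinorProj, map_zero,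
    neg_mul, smul_neg] at h2
  have h3 : (2 * r) • spinorProj = 0 := by
    have := congrArg₂ (· + ·) h h2
    simp only [add_zero] at this
    rw [← this]
    module
  have hr : r = 0 := by
    have := (smul_eq_zero.1 h3).resolve_right spinorProj_ne_zero
    linarith
  refine ⟨hr, ?_⟩
  rw [hr, zero_smul, zero_add] at h
  have h4 := congrArg (cliffTheta * ·) h
  simp only [mul_smul_comm, ← mul_assoc, cliffTheta_mul_self, one_mul, mul_zero] at h4
  exact (smul_eq_zero.1 h4).resolve_right spinorProj_ne_zero

open WordSum in
theorem cliffGen_mul_cliffGen_mul_spinorProj (i k : Fin 7) :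
    i = k ∨ ∃ m, ∃ c : ℤ, cliffGen i * cliffGen k * spinorProj =
      c • (cliffTheta * (cliffGen m * spinorProj)) := by
  have h : ∀ i k : Fin 7, i = k ∨ ∃ m, ∃ c ∈ [(1 : ℤ), -1],
      cancels (times (times (gen i) (gen k)) proj ++
        scale (-1) (scale c (times theta (times (gen m) proj)))) = true := by decide +kernel
  obtain h | ⟨m, c, -, h⟩ := h i k
  · exact .inl h
  · refine .inr ⟨m, c, ?_⟩
    have := eval_eq_of_cancels h
    simpa only [eval_times, eval_scale, eval_gen, eval_proj, eval_theta] using this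

/-- The left ideal generated by the spinor projection, as a span. -/
theorem mul_spinorProj_mem_span (a : Cliff 7) :
    a * spinorProj ∈ Submodule.span ℝ
      ({spinorProj, cliffTheta * spinorProj} ∪ Set.range (fun k => cliffGen k * spinorProj) ∪
        Set.range (fun k => cliffTheta * (cliffGen k * spinorProj))) := by
  set S := Submodule.span ℝ
      ({spinorProj, cliffTheta * spinorProj} ∪ Set.range (fun k => cliffGen k * spinorProj) ∪
        Set.range (fun k => cliffTheta * (cliffGen k * spinorProj))) with hS
  have m1 : spinorProj ∈ S := Submodule.subset_span (by simp)
  have m2 : cliffTheta * spinorProj ∈ S := Submodule.subset_span (by simp)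
  have m3 (k : Fin 7) : cliffGen k * spinorProj ∈ S :=
    Submodule.subset_span (.inl (.inr ⟨k, rfl⟩))
  have m4 (k : Fin 7) : cliffTheta * (cliffGen k * spinorProj) ∈ S :=
    Submodule.subset_span (.inr ⟨k, rfl⟩)
  have comm (i : Fin 7) (x : Cliff 7) : cliffGen i * (cliffTheta * x) = cliffTheta * (cliffGen i * x) := by
    rw [← mul_assoc, ← cliffTheta_mul, mul_assoc]
  have hθθ (x : Cliff 7) : cliffTheta * (cliffTheta * x) = x := by
    rw [← mul_assoc, cliffTheta_mul_self, one_mul]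
  have m5 (i k : Fin 7) : cliffGen i * (cliffGen k * spinorProj) ∈ S ∧
      cliffTheta * (cliffGen i * (cliffGen k * spinorProj)) ∈ S := by
    rw [← mul_assoc (cliffGen i)]
    obtain rfl | ⟨m, c, h⟩ := cliffGen_mul_cliffGen_mul_spinorProj i k
    · rw [cliffGen_mul_self, neg_one_mul, mul_neg]
      exact ⟨S.neg_mem m1, S.neg_mem m2⟩
    · rw [h, mul_smul_comm, hθθ]
      exact ⟨zsmul_mem (m4 m) c, zsmul_mem (m3 m) c⟩
  -- The elements `a` with `a E` in the span contain `1` and are stable under left multiplication by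
  -- generators.
  have := submodule_eq_top_of_cliffGen_mul (P := S.comap (LinearMap.mulRight ℝ spinorProj))
    (by simpa using m1) (fun i x hx => by
      simp only [Submodule.mem_comap, LinearMap.mulRight_apply] at hx ⊢
      rw [mul_assoc]
      generalize x * spinorProj = y at hx
      rw [hS] at hx
      induction hx using Submodule.span_induction with
      | zero => rw [mul_zero]; exact S.zero_mem
      | add y z _ _ hy hz => rw [mul_add]; exact S.add_mem hy hz
      | smul r y _ hy => rw [mul_smul_comm]; exact S.smul_mem r hy
      | mem y hy =>
        rcases hy with ((rfl | rfl) | ⟨k, rfl⟩) | ⟨k, rfl⟩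
        · exact m3 i
        · rw [comm]
          exact m4 i
        · exact (m5 i k).1
        · change cliffGen i * (cliffTheta * (cliffGen k * spinorProj)) ∈ S
          rw [comm]
          exact (m5 i k).2)
  have ha : a ∈ (⊤ : Submodule ℝ (Cliff 7)) := Submodule.mem_top
  rw [← this] at ha
  exact ha

/-- Multiply the spanning set of `A E` by `E` on the left: the terms with an `x_k` vanish and `ℝ[θ]
E` remains. -/
theorem spinorProj_mul_mul_spinorProj (a : Cliff 7) :
    ∃ r s : ℝ, spinorProj * a * spinorProj = r • spinorProj + s • (cliffTheta * spinorProj) := by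
  have key : ∀ y ∈ Submodule.span ℝ
      ({spinorProj, cliffTheta * spinorProj} ∪ Set.range (fun k => cliffGen k * spinorProj) ∪
        Set.range (fun k => cliffTheta * (cliffGen k * spinorProj))),
      spinorProj * y ∈ Submodule.span ℝ {spinorProj, cliffTheta * spinorProj} := by
    intro y hy
    induction hy using Submodule.span_induction with
    | zero => rw [mul_zero]; exact Submodule.zero_mem _
    | add y z _ _ hy hz => rw [mul_add]; exact Submodule.add_mem _ hy hz
    | smul r y _ hy => rw [mul_smul_comm]; exact Submodule.smul_mem _ r hy
    | mem y hy =>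
      have h0 (k : Fin 7) : spinorProj * (cliffGen k * spinorProj) = 0 := by
        rw [← mul_assoc, spinorProj_mul_cliffGen_mul_spinorProj]
      rcases hy with ((rfl | rfl) | ⟨k, rfl⟩) | ⟨k, rfl⟩
      · rw [spinorProj_mul_self]
        exact Submodule.smul_mem _ _ (Submodule.subset_span (by simp))
      · rw [← mul_assoc, ← cliffTheta_mul, mul_assoc, spinorProj_mul_self, mul_smul_comm]
        exact Submodule.smul_mem _ _ (Submodule.subset_span (by simp))
      · change spinorProj * (cliffGen k * spinorProj) ∈ _
        rw [h0]
        exact Submodule.zero_mem _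
      · change spinorProj * (cliffTheta * (cliffGen k * spinorProj)) ∈ _
        rw [← mul_assoc, ← cliffTheta_mul, mul_assoc, h0, mul_zero]
        exact Submodule.zero_mem _
  have := key _ (mul_spinorProj_mem_span a)
  rw [← mul_assoc, Submodule.mem_span_pair] at this
  obtain ⟨r, s, h⟩ := this
  exact ⟨r, s, h.symm⟩

/-- An element is determined by its products with `E` and the `x_k E`. -/
theorem eq_of_mul_spinorProj {a b : Cliff 7} (h0 : a * spinorProj = b * spinorProj)
    (h : ∀ k, a * (cliffGen k * spinorProj) = b * (cliffGen k * spinorProj)) : a = b := by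
  -- Multiply `E - ∑ x_k E x_k = 8` by `c` on the left.
  have h8 (c : Cliff 7) : (8 : ℝ) • c = c * spinorProj -
      ∑ k, c * (cliffGen k * spinorProj) * cliffGen k := by
    rw [← mul_one c, ← mul_smul_comm, ← spinorProj_sub_sum, mul_sub, Finset.mul_sum]
    simp only [mul_one, mul_assoc]
  have : (8 : ℝ) • a = (8 : ℝ) • b := by
    rw [h8, h8, h0]
    simp only [h]
  exact smul_right_injective _ (by norm_num : (8 : ℝ) ≠ 0) this

/-- The even part of the centre is `ℝ`. For central `z` one has `8 z E = E z E`, which lies in `ℝ[θ]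
E`; evenness removes the `θ` term, and centrality carries the scalar from `E` to every `x_k E`. -/
theorem exists_smul_one_of_commutes {z : Cliff 7} (hz : ∀ a, z * a = a * z)
    (h0 : z ∈ cliffGrading 7 0) : ∃ r : ℝ, z = r • 1 := by
  obtain ⟨r, s, h⟩ := spinorProj_mul_mul_spinorProj z
  rw [← hz, mul_assoc, spinorProj_mul_self, mul_smul_comm] at h
  have h1 := congrArg CliffordAlgebra.involute h
  simp only [map_add, map_smul, map_mul, involute_cliffTheta, involute_spinorProj,
    CliffordAlgebra.involute_eq_of_mem_even h0, neg_mul, smul_neg] at h1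
  have h2 := h.symm.trans h1
  have hs : s = 0 := by
    have : (0 : ℝ) • spinorProj + (2 * s) • (cliffTheta * spinorProj) = 0 := by
      have h3 := sub_eq_zero.2 h2
      rw [← h3]
      module
    have := (cliffTheta_mul_spinorProj_cancel this).2
    linarith
  have h4 : z * spinorProj = (r / 8) • spinorProj := by
    apply smul_right_injective _ (by norm_num : (8 : ℝ) ≠ 0)
    change (8 : ℝ) • (z * spinorProj) = (8 : ℝ) • (r / 8) • spinorProj
    rw [h, hs, smul_smul, zero_smul, add_zero]
    congr 1
    ring
  refine ⟨r / 8, eq_of_mul_spinorProj ?_ fun k => ?_⟩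
  · rw [h4, smul_one_mul]
  · rw [← mul_assoc, hz, mul_assoc, h4, smul_one_mul, mul_smul_comm]

end Spinor

/-! ### Generators of `𝔤₂` -/

section G2Generators

attribute [local instance] LieRing.ofAssociativeRing

/-- The infinitesimal rotation in the plane of the coordinates in `p`. -/
def planeRotation (R : Type) [Ring R] (p : Fin 7 × Fin 7) : Matrix (Fin 7) (Fin 7) R :=
  Matrix.of fun i j => if i = p.1 ∧ j = p.2 then 1 else if i = p.2 ∧ j = p.1 then -1 else 0

/-- The difference of two infinitesimal rotations in planes that span lines through `eₖ`. -/
def g2Gen (R : Type) [Ring R] (k : Fin 7) (a : Fin 3) : Matrix (Fin 7) (Fin 7) R :=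
  planeRotation R (octLine k a) - planeRotation R (octLine k (a + 1))

theorem planeRotation_map (p : Fin 7 × Fin 7) :
    (planeRotation ℤ p).map (Int.castRingHom ℝ) = planeRotation ℝ p := by
  ext i j
  simp only [planeRotation, Matrix.map_apply, Matrix.of_apply]
  split_ifs <;> simp

theorem g2Gen_map (k : Fin 7) (a : Fin 3) :
    (Int.castRingHom ℝ).mapMatrix (g2Gen ℤ k a) = g2Gen ℝ k a := by
  rw [g2Gen, map_sub, RingHom.mapMatrix_apply, RingHom.mapMatrix_apply, planeRotation_map,
    planeRotation_map, g2Gen]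

theorem planeRotation_transpose {p : Fin 7 × Fin 7} (hp : p.1 ≠ p.2) :
    (planeRotation ℝ p)ᵀ = -planeRotation ℝ p := by
  ext i j
  simp only [planeRotation, Matrix.transpose_apply, Matrix.neg_apply, Matrix.of_apply]
  split_ifs <;> grind

theorem octLine_ne (k : Fin 7) (a : Fin 3) : (octLine k a).1 ≠ (octLine k a).2 := by
  revert k a
  decide

theorem g2Gen_transpose (k : Fin 7) (a : Fin 3) : (g2Gen ℝ k a)ᵀ = -g2Gen ℝ k a := by
  rw [g2Gen, Matrix.transpose_sub, planeRotation_transpose (octLine_ne _ _),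
    planeRotation_transpose (octLine_ne _ _)]
  abel

theorem planeRotation_mulVec {p : Fin 7 × Fin 7} (hp : p.1 ≠ p.2) (v : Fin 7 → ℝ) (l : Fin 7) :
    (planeRotation ℝ p *ᵥ v) l = if l = p.1 then v p.2 else if l = p.2 then -v p.1 else 0 := by
  simp only [planeRotation, Matrix.mulVec, dotProduct, Matrix.of_apply]
  split_ifs with h1 h2
  · subst h1
    simp [hp]
  · subst h2
    simp [hp.symm]
  · simp [h1, h2]

set_option maxHeartbeats 4000000 in
theorem g2Gen_mem (k : Fin 7) (a : Fin 3) : g2Gen ℝ k a ∈ g2 := by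
  rw [mem_g2, forall_expMemG2_iff]
  refine ⟨g2Gen_transpose k a, fun u v w => ?_⟩
  have h (v : Fin 7 → ℝ) (l : Fin 7) := planeRotation_mulVec (octLine_ne k a) v l
  have h' (v : Fin 7 → ℝ) (l : Fin 7) := planeRotation_mulVec (octLine_ne k (a + 1)) v l
  simp only [octForm_eq, Matrix.det_fin_three, g2Gen, Matrix.sub_mulVec, Pi.sub_apply, h, h']
  clear h h'
  fin_cases k <;> fin_cases a <;> simp [octLine] <;> ring

/-- Every generator is a bracket of generators. -/
theorem exists_bracket_eq_g2Gen (k : Fin 7) (a : Fin 3) : ∃ l b m c,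
    g2Gen ℝ l b * g2Gen ℝ m c - g2Gen ℝ m c * g2Gen ℝ l b = g2Gen ℝ k a := by
  -- Over the integers the search is finite and decidable; the resulting identity is then mapped to
  -- `ℝ`.
  have h : ∀ k a, ∃ l b m c,
      g2Gen ℤ l b * g2Gen ℤ m c - g2Gen ℤ m c * g2Gen ℤ l b = g2Gen ℤ k a := by decide +kernel
  obtain ⟨l, b, m, c, h⟩ := h k a
  refine ⟨l, b, m, c, ?_⟩
  rw [← g2Gen_map, ← g2Gen_map, ← g2Gen_map, ← h, map_sub, map_mul, map_mul]

end G2Generators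

/-! ### The linear equations of `𝔤₂`, a spanning set, and perfectness -/

section G2Span

attribute [local instance] LieRing.ofAssociativeRing

/-- The equations of `𝔤₂` in `𝔰𝔬(7)`. -/
theorem sum_octLine_eq_zero {X : Matrix (Fin 7) (Fin 7) ℝ} (hX : X ∈ g2) (k : Fin 7) :
    ∑ a, X (octLine k a).1 (octLine k a).2 = 0 := by
  rw [mem_g2, forall_expMemG2_iff] at hX
  obtain ⟨ht, hd⟩ := hX
  have hs (i j : Fin 7) : X i j = -X j i := by
    have := congrFun (congrFun ht j) i
    simpa using this
  have hd' (i j l : Fin 7) := hd (Pi.single i 1) (Pi.single j 1) (Pi.single l 1)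
  simp only [Matrix.mulVec_single_one, octForm_eq, Matrix.det_fin_three] at hd'
  rw [Fin.sum_univ_three]
  -- The triple takes one point from each of the three lines of the Fano plane through `k`, such
  -- that the line joining two of them meets the third line in the partner of its chosen point. Then
  -- the three terms of the invariance equation are, up to sign, the three entries in question.
  fin_cases k
  · have h := hd' 1 3 6
    simp [Pi.single_apply] at h
    simp [octLine]
    linarith [hs 2 1, hs 4 3, hs 6 5]
  · have h := hd' 2 3 4
    simp [Pi.single_apply] at h
    simp [octLine]
    linarith [hs 2 0, hs 5 3, hs 6 4]
  · have h := hd' 0 4 6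
    simp [Pi.single_apply] at h
    simp [octLine]
    linarith [hs 0 1, hs 6 3, hs 5 4]
  · have h := hd' 0 1 6
    simp [Pi.single_apply] at h
    simp [octLine]
    linarith [hs 0 4, hs 5 1, hs 6 2]
  · have h := hd' 0 1 5
    simp [Pi.single_apply] at h
    simp [octLine]
    linarith [hs 0 3, hs 6 1, hs 5 2]
  · have h := hd' 0 1 4
    simp [Pi.single_apply] at h
    simp [octLine]
    linarith [hs 0 6, hs 3 1, hs 4 2]
  · have h := hd' 0 1 3
    simp [Pi.single_apply] at h
    simp [octLine]
    linarith [hs 0 5, hs 4 1, hs 3 2]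

theorem eq_sum_planeRotation {X : Matrix (Fin 7) (Fin 7) ℝ} (hX : Xᵀ = -X) :
    X = ∑ k, ∑ a, X (octLine k a).1 (octLine k a).2 • planeRotation ℝ (octLine k a) := by
  have hs (i j : Fin 7) : X i j = -X j i := by
    have := congrFun (congrFun hX j) i
    simpa using this
  -- Two points lie on one line of the Fano plane, so every plane rotation occurs exactly once, up
  -- to orientation.
  have h : ∀ i j : Fin 7, i ≠ j → ∃ k a, (octLine k a = (i, j) ∨ octLine k a = (j, i)) ∧
      ∀ l b, octLine l b = (i, j) ∨ octLine l b = (j, i) → l = k ∧ b = a := by decide +kernel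
  ext i j
  simp only [Matrix.sum_apply, Matrix.smul_apply, planeRotation, Matrix.of_apply, smul_eq_mul]
  by_cases hij : i = j
  · subst hij
    have h0 : X i i = 0 := by linarith [hs i i]
    rw [h0, Finset.sum_eq_zero]
    intro k _
    rw [Finset.sum_eq_zero]
    intro a _
    have := octLine_ne k a
    split_ifs <;> grind
  · obtain ⟨k, a, h1, h2⟩ := h i j hij
    have hz (l b) (hlb : ¬ (l = k ∧ b = a)) : X (octLine l b).1 (octLine l b).2 *
        (if i = (octLine l b).1 ∧ j = (octLine l b).2 then 1 else
          if i = (octLine l b).2 ∧ j = (octLine l b).1 then -1 else 0) = 0 := by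
      rw [if_neg, if_neg, mul_zero]
      · exact fun h => hlb (h2 l b (.inr (Prod.ext h.2.symm h.1.symm)))
      · exact fun h => hlb (h2 l b (.inl (Prod.ext h.1.symm h.2.symm)))
    rw [Finset.sum_eq_single k, Finset.sum_eq_single a]
    · obtain h1 | h1 := h1
      · simp [h1]
      · simp [h1, hij, hs i j]
    · exact fun b _ hb => hz k b fun h => hb h.2
    · simp
    · exact fun l _ hl => Finset.sum_eq_zero fun b _ => hz l b fun h => hl h.1
    · simp

theorem eq_sum_g2Gen {X : Matrix (Fin 7) (Fin 7) ℝ} (hX : X ∈ g2) :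
    ∃ c : Fin 7 → Fin 3 → ℝ, X = ∑ k, ∑ a, c k a • g2Gen ℝ k a := by
  have ht := ((forall_expMemG2_iff X).1 (mem_g2.1 hX)).1
  -- Summation by parts: if `x₀ + x₁ + x₂ = 0`, then `x₀ p₀ + x₁ p₁ + x₂ p₂ = x₀ (p₀ - p₁) + (x₀ +
  -- x₁)(p₁ - p₂)`.
  refine ⟨fun k => ![X (octLine k 0).1 (octLine k 0).2,
    X (octLine k 0).1 (octLine k 0).2 + X (octLine k 1).1 (octLine k 1).2, 0], ?_⟩
  conv_lhs => rw [eq_sum_planeRotation ht]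
  refine Finset.sum_congr rfl fun k _ => ?_
  have h := sum_octLine_eq_zero hX k
  rw [Fin.sum_univ_three] at h ⊢
  rw [Fin.sum_univ_three, eq_neg_of_add_eq_zero_right h]
  simp only [g2Gen, Matrix.cons_val]
  have e1 : (0 : Fin 3) + 1 = 1 := rfl
  have e2 : (1 : Fin 3) + 1 = 2 := rfl
  rw [e1, e2]
  module

/-- The generators of `𝔤₂`, as elements of `𝔤₂`. -/
noncomputable def g2Elem (k : Fin 7) (a : Fin 3) : g2 := ⟨g2Gen ℝ k a, g2Gen_mem k a⟩

theorem span_g2Elem : Submodule.span ℝ (Set.range fun p : Fin 7 × Fin 3 => g2Elem p.1 p.2) = ⊤ := by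
  rw [eq_top_iff]
  rintro ⟨X, hX⟩ -
  obtain ⟨c, hc⟩ := eq_sum_g2Gen hX
  have : (⟨X, hX⟩ : g2) = ∑ k, ∑ a, c k a • g2Elem k a := by
    apply Subtype.ext
    change X = g2.toSubmodule.subtype (∑ k, ∑ a, c k a • g2Elem k a)
    rw [hc]
    simp only [map_sum, map_smul]
    rfl
  rw [this]
  exact Submodule.sum_mem _ fun k _ => Submodule.sum_mem _ fun a _ =>
    Submodule.smul_mem _ _ (Submodule.subset_span ⟨(k, a), rfl⟩)

theorem exists_lie_eq_g2Elem (k : Fin 7) (a : Fin 3) : ∃ X Y : g2, ⁅X, Y⁆ = g2Elem k a := by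
  obtain ⟨l, b, m, c, h⟩ := exists_bracket_eq_g2Gen k a
  exact ⟨g2Elem l b, g2Elem m c, Subtype.ext h⟩

/-- The Lie algebra `𝔤₂` is perfect. -/
theorem linearMap_g2_eq_of_lie {V : Type} [AddCommGroup V] [Module ℝ V] {f f' : g2 →ₗ[ℝ] V}
    (h : ∀ X Y : g2, f ⁅X, Y⁆ = f' ⁅X, Y⁆) : f = f' := by
  refine LinearMap.ext_on_range span_g2Elem ?_
  rintro ⟨k, a⟩
  obtain ⟨X, Y, hXY⟩ := exists_lie_eq_g2Elem k a
  rw [← hXY, h]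

end G2Span

/-! ### The comoment map -/

section Comoment

attribute [local instance] LieRing.ofAssociativeRing

/-- The quadratic element of the Clifford algebra that corresponds to a matrix. -/
noncomputable def spinLift {n : ℕ} : Matrix (Fin n) (Fin n) ℝ →ₗ[ℝ] Cliff n where
  toFun X := (-(1 / 4) : ℝ) • ∑ i, ∑ j, X i j • (cliffGen i * cliffGen j)
  map_add' X Y := by
    simp only [Matrix.add_apply, add_smul, Finset.sum_add_distrib, smul_add]
  map_smul' r X := by
    simp only [Matrix.smul_apply, smul_eq_mul, mul_smul, ← Finset.smul_sum, RingHom.id_apply]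
    rw [smul_comm]

theorem spinLift_apply {n : ℕ} (X : Matrix (Fin n) (Fin n) ℝ) :
    spinLift X = (-(1 / 4) : ℝ) • ∑ i, ∑ j, X i j • (cliffGen i * cliffGen j : Cliff n) := rfl

theorem spinLift_even {n : ℕ} (X : Matrix (Fin n) (Fin n) ℝ) : spinLift X ∈ cliffGrading n 0 :=
  Submodule.smul_mem _ _ (Submodule.sum_mem _ fun _ _ => Submodule.sum_mem _ fun _ _ =>
    Submodule.smul_mem _ _ (CliffordAlgebra.ι_mul_ι_mem_evenOdd_zero _ _ _))

theorem ι_eq_sum_cliffGen {n : ℕ} (v : Fin n → ℝ) :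
    (CliffordAlgebra.ι _ v : Cliff n) = ∑ i, v i • cliffGen i := by
  conv_lhs => rw [← Finset.univ_sum_single v, map_sum]
  refine Finset.sum_congr rfl fun i _ => ?_
  rw [cliffGen, ← map_smul, ← Pi.single_smul, smul_eq_mul, mul_one]

theorem cliffGen_commutator {n : ℕ} (i j k : Fin n) :
    (cliffGen i * cliffGen j * cliffGen k - cliffGen k * (cliffGen i * cliffGen j) : Cliff n) =
      (if i = k then (2 : ℝ) else 0) • cliffGen j - (if j = k then (2 : ℝ) else 0) • cliffGen i := by
  have h1 := cliffGen_mul_add_swap j k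
  have h2 := cliffGen_mul_add_swap i k
  have h : (cliffGen i * cliffGen j * cliffGen k - cliffGen k * (cliffGen i * cliffGen j) : Cliff n)
      = cliffGen i * (cliffGen j * cliffGen k + cliffGen k * cliffGen j)
        - (cliffGen i * cliffGen k + cliffGen k * cliffGen i) * cliffGen j := by
    noncomm_ring
  rw [h, h1, h2]
  split_ifs <;> simp [ofNat_smul_eq_nsmul] <;> noncomm_ring

/-- The commutator of `x_i x_j` with a vector is a vector. The factor `-1/4` compensates the `2`
from the Clifford relation and the double count of each plane by `(i, j)` and `(j, i)`. -/
theorem spinLift_commutator {n : ℕ} {X : Matrix (Fin n) (Fin n) ℝ} (hX : Xᵀ = -X)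
    (v : Fin n → ℝ) :
    spinLift X * CliffordAlgebra.ι _ v - CliffordAlgebra.ι _ v * spinLift X =
      CliffordAlgebra.ι _ (X *ᵥ v) := by
  have hs (i j : Fin n) : X i j = -X j i := by
    have := congrFun (congrFun hX j) i
    simpa using this
  have key (k : Fin n) : spinLift X * cliffGen k - cliffGen k * spinLift X =
      ∑ i, X i k • cliffGen i := by
    rw [spinLift_apply, smul_mul_assoc, mul_smul_comm, ← smul_sub]
    simp only [Finset.sum_mul, Finset.mul_sum, ← Finset.sum_sub_distrib, smul_mul_assoc,
      mul_smul_comm, ← smul_sub, cliffGen_commutator]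
    have h1 : ∑ i, ∑ j, X i j • (if i = k then (2 : ℝ) else 0) • (cliffGen j : Cliff n) =
        -(2 : ℝ) • ∑ j, X j k • cliffGen j := by
      rw [Finset.sum_comm, Finset.smul_sum]
      refine Finset.sum_congr rfl fun j _ => ?_
      rw [Finset.sum_eq_single k (fun i _ hi => by rw [if_neg hi, zero_smul, smul_zero]) (by simp),
        if_pos rfl, hs k j]
      module
    have h2 : ∑ i, ∑ j, X i j • (if j = k then (2 : ℝ) else 0) • (cliffGen i : Cliff n) =
        (2 : ℝ) • ∑ i, X i k • cliffGen i := by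
      rw [Finset.smul_sum]
      refine Finset.sum_congr rfl fun i _ => ?_
      rw [Finset.sum_eq_single k (fun j _ hj => by rw [if_neg hj, zero_smul, smul_zero]) (by simp),
        if_pos rfl, smul_comm]
    simp only [smul_sub, Finset.sum_sub_distrib]
    rw [h1, h2]
    module
  rw [ι_eq_sum_cliffGen v, ι_eq_sum_cliffGen, Finset.mul_sum, Finset.sum_mul,
    ← Finset.sum_sub_distrib]
  simp only [mul_smul_comm, smul_mul_assoc, ← smul_sub, key, Matrix.mulVec, dotProduct]
  simp only [Finset.smul_sum, Finset.sum_smul, smul_smul]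
  rw [Finset.sum_comm]
  simp only [mul_comm]

theorem spinLift_planeRotation {p : Fin 7 × Fin 7} (hp : p.1 ≠ p.2) :
    spinLift (planeRotation ℝ p) = (-(1 / 2) : ℝ) • (cliffGen p.1 * cliffGen p.2) := by
  have h : ∀ i j, planeRotation ℝ p i j • (cliffGen i * cliffGen j : Cliff 7) =
      (if i = p.1 then if j = p.2 then cliffGen i * cliffGen j else 0 else 0) -
      (if i = p.2 then if j = p.1 then cliffGen i * cliffGen j else 0 else 0) := by
    intro i j
    simp only [planeRotation, Matrix.of_apply]
    split_ifs <;> simp_all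
  have hs := cliffGen_mul_add_swap p.1 p.2
  rw [if_neg hp] at hs
  rw [spinLift_apply]
  simp only [h, Finset.sum_sub_distrib, Finset.sum_ite_irrel, Finset.sum_const_zero,
    Finset.sum_ite_eq', Finset.mem_univ, if_true]
  rw [eq_neg_of_add_eq_zero_right hs]
  module

theorem spinLift_g2Gen (k : Fin 7) (a : Fin 3) :
    spinLift (g2Gen ℝ k a) = (-(1 / 2) : ℝ) • spinGen k a := by
  rw [g2Gen, map_sub, spinLift_planeRotation (octLine_ne _ _),
    spinLift_planeRotation (octLine_ne _ _), spinGen, smul_sub]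

theorem spinLift_mul_spinorProj (X : g2) :
    spinLift (X : Matrix (Fin 7) (Fin 7) ℝ) * spinorProj = 0 := by
  have : LinearMap.mulRight ℝ spinorProj ∘ₗ spinLift ∘ₗ g2.toSubmodule.subtype = 0 := by
    refine LinearMap.ext_on_range span_g2Elem ?_
    rintro ⟨k, a⟩
    change spinLift (g2Gen ℝ k a) * spinorProj = 0
    rw [spinLift_g2Gen, smul_mul_assoc, spinGen_mul_spinorProj, smul_zero]
  exact LinearMap.congr_fun this X

theorem g2_transpose (X : g2) : (X : Matrix (Fin 7) (Fin 7) ℝ)ᵀ = -X :=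
  ((forall_expMemG2_iff _).1 (mem_g2.1 X.2)).1

theorem commutes_of_ι {n : ℕ} {z : Cliff n}
    (h : ∀ v, z * CliffordAlgebra.ι _ v - CliffordAlgebra.ι _ v * z = 0) (a : Cliff n) :
    z * a = a * z :=
  commutes_of_cliffGen (fun _ => sub_eq_zero.1 (h _)) a

/-- No expansion of the quadratic terms is needed. The defect commutes with all vectors by the
Jacobi identity, so it is even and central, hence a scalar; it kills `E`, so the scalar is zero. -/
theorem spinLift_lie (X Y : g2) :
    spinLift ((⁅X, Y⁆ : g2) : Matrix (Fin 7) (Fin 7) ℝ) =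
      spinLift (X : Matrix (Fin 7) (Fin 7) ℝ) * spinLift (Y : Matrix (Fin 7) (Fin 7) ℝ) -
        spinLift (Y : Matrix (Fin 7) (Fin 7) ℝ) * spinLift (X : Matrix (Fin 7) (Fin 7) ℝ) := by
  have hb : ((⁅X, Y⁆ : g2) : Matrix (Fin 7) (Fin 7) ℝ) = X.1 * Y.1 - Y.1 * X.1 := rfl
  have hx := fun v => spinLift_commutator (g2_transpose X) v
  have hy := fun v => spinLift_commutator (g2_transpose Y) v
  have hxy := fun v => spinLift_commutator (g2_transpose ⁅X, Y⁆) v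
  have hX0 := spinLift_mul_spinorProj X
  have hY0 := spinLift_mul_spinorProj Y
  have hXY0 := spinLift_mul_spinorProj ⁅X, Y⁆
  have heX := spinLift_even (X : Matrix (Fin 7) (Fin 7) ℝ)
  have heY := spinLift_even (Y : Matrix (Fin 7) (Fin 7) ℝ)
  have heXY := spinLift_even ((⁅X, Y⁆ : g2) : Matrix (Fin 7) (Fin 7) ℝ)
  rw [hb] at *
  set x := spinLift (X : Matrix (Fin 7) (Fin 7) ℝ)
  set y := spinLift (Y : Matrix (Fin 7) (Fin 7) ℝ)
  set z := spinLift (X.1 * Y.1 - Y.1 * X.1)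
  obtain ⟨r, hr⟩ := exists_smul_one_of_commutes (z := z - (x * y - y * x))
    (commutes_of_ι fun v => by
      have e : (z - (x * y - y * x)) * CliffordAlgebra.ι _ v -
          CliffordAlgebra.ι _ v * (z - (x * y - y * x)) =
          (z * CliffordAlgebra.ι _ v - CliffordAlgebra.ι _ v * z)
          - (x * (y * CliffordAlgebra.ι _ v - CliffordAlgebra.ι _ v * y)
            - (y * CliffordAlgebra.ι _ v - CliffordAlgebra.ι _ v * y) * x)
          + (y * (x * CliffordAlgebra.ι _ v - CliffordAlgebra.ι _ v * x)
            - (x * CliffordAlgebra.ι _ v - CliffordAlgebra.ι _ v * x) * y) := by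
        noncomm_ring
      rw [e, hxy, hx, hy, hx, hy, Matrix.sub_mulVec, map_sub, Matrix.mulVec_mulVec,
        Matrix.mulVec_mulVec]
      abel)
    (sub_mem heXY (sub_mem
      (add_zero (0 : ZMod 2) ▸ SetLike.mul_mem_graded heX heY)
      (add_zero (0 : ZMod 2) ▸ SetLike.mul_mem_graded heY heX)))
  have h0 : (z - (x * y - y * x)) * spinorProj = 0 := by
    rw [sub_mul, sub_mul, mul_assoc, mul_assoc, hX0, hY0, hXY0]
    simp
  rw [hr, smul_one_mul] at h0
  rw [(smul_eq_zero.1 h0).resolve_right spinorProj_ne_zero, zero_smul] at hr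
  exact sub_eq_zero.1 hr

theorem g2Action_ι (g : G2) (v : Fin 7 → ℝ) :
    g2Action g (CliffordAlgebra.ι _ v) =
      CliffordAlgebra.ι _ ((g : Matrix (Fin 7) (Fin 7) ℝ) *ᵥ v) :=
  CliffordAlgebra.map_apply_ι _ _

/-- Leibniz rule, by induction on words. The functional must vary in the induction: the generator
`x_i` split off on the left is absorbed by replacing `φ` with `φ (x_i * ·)`. -/
theorem hasDerivAt_g2Action (X : g2) (a : Cliff 7) (φ : Cliff 7 →ₗ[ℝ] ℝ) :
    HasDerivAt (fun t : ℝ => φ (g2Action (g2Exp X t) a))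
      (φ (spinLift (X : Matrix (Fin 7) (Fin 7) ℝ) * a
        - a * spinLift (X : Matrix (Fin 7) (Fin 7) ℝ))) 0 := by
  set x := spinLift (X : Matrix (Fin 7) (Fin 7) ℝ) with hx
  have h0 (a : Cliff 7) : g2Action (g2Exp X 0) a = a := by
    have : g2Exp X 0 = 1 := by
      apply Subtype.ext
      apply Subtype.ext
      change NormedSpace.exp ((0 : ℝ) • (X : Matrix (Fin 7) (Fin 7) ℝ)) = 1
      rw [zero_smul, NormedSpace.exp_zero]
    rw [this, map_one]
    rfl
  induction a using CliffordAlgebra.left_induction generalizing φ with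
  | algebraMap r =>
    simp only [AlgHom.commutes]
    rw [Algebra.commutes, sub_self, map_zero]
    exact hasDerivAt_const _ _
  | add a b ha hb =>
    simp only [map_add]
    refine ((ha φ).add (hb φ)).congr_deriv ?_
    rw [← map_add]
    congr 1
    noncomm_ring
  | ι_mul a v ha =>
    have hv := hasDerivAt_exp_mulVec (X : Matrix (Fin 7) (Fin 7) ℝ) v 0
    rw [zero_smul, NormedSpace.exp_zero, Matrix.one_mulVec] at hv
    have hvi := hasDerivAt_pi.1 hv
    have e (t : ℝ) : φ (g2Action (g2Exp X t) (CliffordAlgebra.ι _ v * a)) =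
        ∑ i, (NormedSpace.exp (t • (X : Matrix (Fin 7) (Fin 7) ℝ)) *ᵥ v) i *
          φ (cliffGen i * g2Action (g2Exp X t) a) := by
      rw [map_mul, g2Action_ι, ι_eq_sum_cliffGen, Finset.sum_mul, map_sum]
      simp only [smul_mul_assoc, map_smul, smul_eq_mul]
      rfl
    simp only [e]
    have hd : HasDerivAt (fun t : ℝ => ∑ i,
        (NormedSpace.exp (t • (X : Matrix (Fin 7) (Fin 7) ℝ)) *ᵥ v) i *
          φ (cliffGen i * g2Action (g2Exp X t) a))
        (∑ i, (((X : Matrix (Fin 7) (Fin 7) ℝ) *ᵥ v) i * φ (cliffGen i * a) +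
          v i * φ (cliffGen i * (x * a - a * x)))) 0 := by
      refine HasDerivAt.fun_sum fun i _ => ?_
      have h1 := ha (φ ∘ₗ LinearMap.mulLeft ℝ (cliffGen i))
      refine ((hvi i).mul h1).congr_deriv ?_
      simp [h0]
    refine hd.congr_deriv ?_
    have hs (w : Fin 7 → ℝ) (b : Cliff 7) :
        φ (CliffordAlgebra.ι _ w * b) = ∑ i, w i * φ (cliffGen i * b) := by
      rw [ι_eq_sum_cliffGen, Finset.sum_mul, map_sum]
      simp only [smul_mul_assoc, map_smul, smul_eq_mul]
    rw [Finset.sum_add_distrib, ← hs, ← hs, ← map_add, ← spinLift_commutator (g2_transpose X)]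
    congr 1
    rw [← hx]
    noncomm_ring

/-- The comoment map of `G₂`. -/
noncomputable def g2Comoment : G2ComomentMap where
  toLinearMap := spinLift ∘ₗ g2.toSubmodule.subtype
  map_lie := spinLift_lie
  even _ := spinLift_even _
  hasDerivAt := hasDerivAt_g2Action

theorem eq_of_functionals {V : Type} [AddCommGroup V] [Module ℝ V] {a b : V}
    (h : ∀ φ : V →ₗ[ℝ] ℝ, φ a = φ b) : a = b :=
  Module.forall_dual_apply_eq_zero_iff ℝ (a - b) |>.1
    (fun φ => by rw [map_sub, h, sub_self]) |> sub_eq_zero.1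

/-- The derivation determines the comoment map up to even central elements, i.e. scalars. Scalars
drop out of commutators, and brackets span `𝔤₂`. -/
theorem g2ComomentMap_eq (μ : G2ComomentMap) : μ = g2Comoment := by
  have hlin : μ.toLinearMap = g2Comoment.toLinearMap := by
    have hd (X : g2) : ∃ r : ℝ, μ.toLinearMap X = g2Comoment.toLinearMap X + r • 1 := by
      obtain ⟨r, hr⟩ := exists_smul_one_of_commutes
        (z := μ.toLinearMap X - g2Comoment.toLinearMap X)
        (fun a => by
          have := eq_of_functionals fun φ =>
            (μ.hasDerivAt X a φ).unique (g2Comoment.hasDerivAt X a φ)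
          rw [sub_mul, mul_sub, sub_eq_sub_iff_sub_eq_sub, this])
        (sub_mem (μ.even X) (g2Comoment.even X))
      exact ⟨r, by rw [← hr]; abel⟩
    apply linearMap_g2_eq_of_lie
    intro X Y
    obtain ⟨r, hr⟩ := hd X
    obtain ⟨s, hs⟩ := hd Y
    rw [μ.map_lie, g2Comoment.map_lie, hr, hs]
    simp only [mul_add, add_mul, smul_one_mul, mul_smul_one]
    module
  cases μ
  cases hlin
  rfl

end Comoment

/-! ### Invariants of `G₂` -/

section Invariants

attribute [local instance] LieRing.ofAssociativeRing

theorem coe_inv_G2 (g : G2) :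
    ((g⁻¹ : G2) : Matrix (Fin 7) (Fin 7) ℝ) = (g : Matrix (Fin 7) (Fin 7) ℝ)ᵀ := by
  ext i j
  rfl

/-- The rows of an orthogonal matrix are the images of the basis vectors under its inverse, which
also lies in `G₂`. -/
theorem octForm_row (g : G2) (p q r : Fin 7) :
    octForm ((g : Matrix (Fin 7) (Fin 7) ℝ) p) ((g : Matrix (Fin 7) (Fin 7) ℝ) q)
      ((g : Matrix (Fin 7) (Fin 7) ℝ) r) =
      octForm (Pi.single p 1) (Pi.single q 1) (Pi.single r 1) := by
  have h := (g⁻¹).2 (Pi.single p 1) (Pi.single q 1) (Pi.single r 1)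
  change octForm (((g⁻¹ : G2) : Matrix (Fin 7) (Fin 7) ℝ) *ᵥ _)
    (((g⁻¹ : G2) : Matrix (Fin 7) (Fin 7) ℝ) *ᵥ _) (((g⁻¹ : G2) : Matrix (Fin 7) (Fin 7) ℝ) *ᵥ _)
    = _ at h
  rw [coe_inv_G2] at h
  simp only [Matrix.mulVec_single_one] at h
  exact h

/-- Moves a matrix from the generators to an argument of the form; applied once for each of the
three indices of `ε`. -/
theorem sum_smul_sum_row {V : Type} [AddCommGroup V] [Module ℝ V] {n : ℕ}
    (φ : (Fin n → ℝ) →ₗ[ℝ] ℝ) (g : Matrix (Fin n) (Fin n) ℝ) (w : Fin n → V) :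
    ∑ i, φ (Pi.single i 1) • ∑ p, g p i • w p = ∑ p, φ (g p) • w p := by
  simp only [Finset.smul_sum, smul_smul]
  rw [Finset.sum_comm]
  refine Finset.sum_congr rfl fun p _ => ?_
  rw [← Finset.sum_smul]
  congr 1
  conv_rhs => rw [← Finset.univ_sum_single (g p), map_sum]
  refine Finset.sum_congr rfl fun i _ => ?_
  rw [mul_comm, ← smul_eq_mul, ← map_smul, ← Pi.single_smul, smul_eq_mul, mul_one]

theorem g2Action_cliffGen (g : G2) (i : Fin 7) :
    g2Action g (cliffGen i) = ∑ p, (g : Matrix (Fin 7) (Fin 7) ℝ) p i • cliffGen p := by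
  rw [cliffGen, g2Action_ι, ι_eq_sum_cliffGen]
  simp

theorem g2Action_cliffEpsilon (g : G2) : g2Action g cliffEpsilon = cliffEpsilon := by
  apply smul_right_injective _ (by norm_num : (6 : ℝ) ≠ 0)
  change (6 : ℝ) • g2Action g cliffEpsilon = (6 : ℝ) • cliffEpsilon
  rw [← map_smul, six_smul_cliffEpsilon]
  set M := (g : Matrix (Fin 7) (Fin 7) ℝ) with hM
  simp only [map_sum, map_smul, map_mul]
  have h3 (a b : Fin 7 → ℝ) (y : Cliff 7) :
      ∑ k, octForm a b (Pi.single k 1) • (y * g2Action g (cliffGen k)) =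
        ∑ r, octForm a b (M r) • (y * cliffGen r) := by
    have := sum_smul_sum_row
      (⟨⟨fun c => octForm a b c, fun _ _ => octForm_add₃ _ _ _ _⟩,
        fun _ _ => octForm_smul₃ _ _ _ _⟩ : (Fin 7 → ℝ) →ₗ[ℝ] ℝ) M (fun r => y * cliffGen r)
    simp only [g2Action_cliffGen, Finset.mul_sum, mul_smul_comm]
    exact this
  have h2 (a c : Fin 7 → ℝ) (y z : Cliff 7) :
      ∑ j, octForm a (Pi.single j 1) c • (y * g2Action g (cliffGen j) * z) =
        ∑ q, octForm a (M q) c • (y * cliffGen q * z) := by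
    have := sum_smul_sum_row
      (⟨⟨fun b => octForm a b c, fun _ _ => octForm_add₂ _ _ _ _⟩,
        fun _ _ => octForm_smul₂ _ _ _ _⟩ : (Fin 7 → ℝ) →ₗ[ℝ] ℝ) M (fun r => y * cliffGen r * z)
    simp only [g2Action_cliffGen, Finset.mul_sum, Finset.sum_mul, mul_smul_comm, smul_mul_assoc]
    exact this
  have h1 (b c : Fin 7 → ℝ) (z w : Cliff 7) :
      ∑ i, octForm (Pi.single i 1) b c • (g2Action g (cliffGen i) * z * w) =
        ∑ p, octForm (M p) b c • (cliffGen p * z * w) := by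
    have := sum_smul_sum_row
      (⟨⟨fun a => octForm a b c, fun _ _ => octForm_add₁ _ _ _ _⟩,
        fun _ _ => octForm_smul₁ _ _ _ _⟩ : (Fin 7 → ℝ) →ₗ[ℝ] ℝ) M (fun r => cliffGen r * z * w)
    simp only [g2Action_cliffGen, Finset.sum_mul, smul_mul_assoc]
    exact this
  calc
    _ = ∑ i, ∑ j, ∑ r, octForm (Pi.single i 1) (Pi.single j 1) (M r) •
        (g2Action g (cliffGen i) * g2Action g (cliffGen j) * cliffGen r) := by simp only [h3]
    _ = ∑ r, ∑ i, ∑ j, octForm (Pi.single i 1) (Pi.single j 1) (M r) •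
        (g2Action g (cliffGen i) * g2Action g (cliffGen j) * cliffGen r) :=
      (Finset.sum_congr rfl fun i _ => Finset.sum_comm).trans Finset.sum_comm
    _ = ∑ r, ∑ i, ∑ q, octForm (Pi.single i 1) (M q) (M r) •
        (g2Action g (cliffGen i) * cliffGen q * cliffGen r) := by simp only [h2]
    _ = ∑ r, ∑ q, ∑ i, octForm (Pi.single i 1) (M q) (M r) •
        (g2Action g (cliffGen i) * cliffGen q * cliffGen r) :=
      Finset.sum_congr rfl fun r _ => Finset.sum_comm
    _ = ∑ r, ∑ q, ∑ p, octForm (M p) (M q) (M r) • (cliffGen p * cliffGen q * cliffGen r) := by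
      simp only [h1]
    _ = _ := by
      simp only [hM, octForm_row]
      exact ((Finset.sum_congr rfl fun r _ => Finset.sum_comm).trans Finset.sum_comm).trans
        (Finset.sum_congr rfl fun p _ => Finset.sum_comm)

theorem cliffEpsilon_mul_self : cliffEpsilon * cliffEpsilon = 7 - 6 * (cliffTheta * cliffEpsilon) := by
  rw [← cliffTheta_mul_cliffEpsilon_sq, cliffTheta_mul cliffEpsilon, mul_assoc,
    ← mul_assoc cliffTheta, cliffTheta_mul cliffEpsilon, mul_assoc, cliffTheta_mul_self, mul_one]

/-- No determinant is used. The equation `ε² = 7 - 6 θ ε` and the invariance of `ε` give `(g θ - θ)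
ε = 0`, and `ε` can be cancelled. -/
theorem g2Action_cliffTheta (g : G2) : g2Action g cliffTheta = cliffTheta := by
  have h := cliffEpsilon_mul_self
  have hg := congrArg (g2Action g) h
  simp only [map_mul, map_sub, map_ofNat, g2Action_cliffEpsilon] at hg
  set t := g2Action g cliffTheta
  have h6 (x : Cliff 7) : (6 : ℝ) • x = 6 * x := by
    rw [ofNat_smul_eq_nsmul, nsmul_eq_mul, Nat.cast_ofNat]
  have h1 : (6 : ℝ) • ((t - cliffTheta) * cliffEpsilon) = 0 := by
    have := hg.symm.trans h
    rw [sub_right_inj] at this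
    rw [sub_mul, smul_sub, h6, h6, this, sub_self]
  have h2 := (smul_eq_zero.1 h1).resolve_left (by norm_num)
  -- The same quadratic equation shows that `(ε + 6 θ) / 7` is a right inverse of `ε`.
  have h3 : cliffEpsilon * (cliffEpsilon + (6 : ℝ) • cliffTheta) = (7 : ℝ) • 1 := by
    rw [mul_add, h, mul_smul_comm, cliffTheta_mul, h6, sub_add_cancel, ofNat_smul_eq_nsmul,
      nsmul_one, Nat.cast_ofNat]
  have h4 : (7 : ℝ) • (t - cliffTheta) = 0 := by
    rw [← mul_one (t - cliffTheta), ← mul_smul_comm, ← h3, ← mul_assoc, h2, zero_mul]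
  exact sub_eq_zero.1 ((smul_eq_zero.1 h4).resolve_left (by norm_num))

theorem g2Action_spinorProj (g : G2) : g2Action g spinorProj = spinorProj := by
  rw [spinorProj, map_sub, map_one, map_mul, g2Action_cliffEpsilon, g2Action_cliffTheta]

theorem spinGen_eq_g2Comoment (k : Fin 7) (a : Fin 3) :
    spinGen k a = (-2 : ℝ) • g2Comoment.toLinearMap (g2Elem k a) := by
  change _ = (-2 : ℝ) • spinLift (g2Gen ℝ k a)
  rw [spinLift_g2Gen]
  module

/-- One inclusion is the invariance of the spinor. For the other, `a E = 0` turns the Casimir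
identity into `a = -(1/48) a ∑ spinGen²`, which lies in the left ideal. -/
theorem mem_g2Comoment_leftIdeal {a : Cliff 7} :
    a ∈ g2Comoment.leftIdeal ↔ a * spinorProj = 0 := by
  constructor
  · intro h
    induction h using Submodule.span_induction with
    | mem x hx =>
      obtain ⟨X, rfl⟩ := hx
      exact spinLift_mul_spinorProj X
    | zero => exact zero_mul _
    | add x y _ _ hx hy => rw [add_mul, hx, hy, add_zero]
    | smul b x _ hx => rw [smul_eq_mul, mul_assoc, hx, mul_zero]
  · intro h
    have hs (k : Fin 7) (a : Fin 3) : spinGen k a ∈ g2Comoment.leftIdeal := by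
      rw [spinGen_eq_g2Comoment, ← smul_one_mul]
      exact Ideal.mul_mem_left _ _ (Ideal.subset_span ⟨_, rfl⟩)
    have h1 := congrArg (a * ·) sum_spinGen_mul_self
    simp only [mul_sub, mul_smul_comm, h, smul_zero, zero_sub, mul_one] at h1
    have h2 : a = (-(1 / 48) : ℝ) • (a * ∑ k, ∑ b, spinGen k b * spinGen k b) := by
      rw [h1]
      module
    rw [h2, ← smul_one_mul]
    exact Ideal.mul_mem_left _ _ (Ideal.mul_mem_left _ _ (Submodule.sum_mem _ fun k _ =>
      Submodule.sum_mem _ fun b _ => Ideal.mul_mem_left _ _ (hs k b)))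

/-! ### Action of invariant classes and invariant elements on the spinors -/

theorem smul_one_add_smul_theta_mul (r s : ℝ) (x : Cliff 7) :
    (r • 1 + s • cliffTheta) * x = r • x + s • (cliffTheta * x) := by
  rw [add_mul, smul_one_mul, smul_mul_assoc]

theorem smul_one_add_smul_theta_mem_fixed (r s : ℝ) :
    r • 1 + s • cliffTheta ∈ fixedSubalgebra g2Action := fun g => by
  rw [map_add, map_smul, map_smul, map_one, g2Action_cliffTheta]

theorem fixed_le_lifts (μ : G2ComomentMap) {a : Cliff 7} (ha : a ∈ fixedSubalgebra g2Action) :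
    a ∈ μ.lifts := fun g => by
  rw [ha g, sub_self]
  exact zero_mem _

/-- The hypothesis says that `E / 8` fixes `a E` from the left, so `a E = E a E / 8` lies in the
corner. -/
theorem mul_spinorProj_of_mul_eq {a : Cliff 7}
    (h : (spinorProj - (8 : ℝ) • 1) * (a * spinorProj) = 0) :
    ∃ r s : ℝ, a * spinorProj = (r • 1 + s • cliffTheta) * spinorProj := by
  obtain ⟨r, s, hrs⟩ := spinorProj_mul_mul_spinorProj a
  rw [sub_mul, smul_one_mul, ← mul_assoc, hrs, sub_eq_zero] at h
  refine ⟨r / 8, s / 8, smul_right_injective _ (by norm_num : (8 : ℝ) ≠ 0) ?_⟩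
  change (8 : ℝ) • _ = (8 : ℝ) • _
  rw [← h, smul_one_add_smul_theta_mul]
  module

/-- If the class of `a` is invariant, then `𝔤₂` kills `a E`, and so does the Casimir element, a
multiple of `E - 8`. -/
theorem exists_mul_spinorProj_of_mem_lifts {a : Cliff 7} (ha : a ∈ g2Comoment.lifts) :
    ∃ r s : ℝ, a * spinorProj = (r • 1 + s • cliffTheta) * spinorProj := by
  apply mul_spinorProj_of_mul_eq
  have hs (k : Fin 7) (b : Fin 3) : spinGen k b * (a * spinorProj) = 0 := by
    have := mem_g2Comoment_leftIdeal.1 (g2Comoment.apply_mul_mem ha (g2Elem k b))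
    rw [spinGen_eq_g2Comoment, smul_mul_assoc, ← mul_assoc, this, smul_zero]
  have h := congrArg (· * (a * spinorProj)) sum_spinGen_mul_self
  simp only [Finset.sum_mul, mul_assoc, hs, mul_zero, Finset.sum_const_zero] at h
  have h6 : (6 : ℝ) • ((spinorProj - (8 : ℝ) • 1) * (a * spinorProj)) = 0 := by
    rw [← smul_mul_assoc]
    refine Eq.trans ?_ h.symm
    congr 1
    module
  exact (smul_eq_zero.1 h6).resolve_left (by norm_num)

theorem exists_fixed_of_mem_lifts {a : Cliff 7} (ha : a ∈ g2Comoment.lifts) :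
    ∃ r s : ℝ, a - (r • 1 + s • cliffTheta) ∈ g2Comoment.leftIdeal := by
  obtain ⟨r, s, h⟩ := exists_mul_spinorProj_of_mem_lifts ha
  exact ⟨r, s, mem_g2Comoment_leftIdeal.2 (by rw [sub_mul, h, sub_self])⟩

theorem g2Action_mem_leftIdeal (g : G2) {a : Cliff 7} (ha : a ∈ g2Comoment.leftIdeal) :
    g2Action g a ∈ g2Comoment.leftIdeal := by
  rw [mem_g2Comoment_leftIdeal] at ha ⊢
  rw [← g2Action_spinorProj g, ← map_mul, ha, map_zero]

theorem spinGen_mul_comm_of_fixed {a : Cliff 7} (ha : a ∈ fixedSubalgebra g2Action) (k : Fin 7)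
    (b : Fin 3) : spinGen k b * a = a * spinGen k b := by
  have h (X : g2) : g2Comoment.toLinearMap X * a - a * g2Comoment.toLinearMap X = 0 := by
    refine eq_of_functionals fun φ => ?_
    have hd := g2Comoment.hasDerivAt X a φ
    have hc : (fun t : ℝ => φ (g2Action (g2Exp X t) a)) = fun _ => φ a :=
      funext fun t => congrArg φ (ha _)
    rw [hc] at hd
    rw [map_zero]
    exact hd.unique (hasDerivAt_const _ _)
  rw [spinGen_eq_g2Comoment, smul_mul_assoc, mul_smul_comm, sub_eq_zero.1 (h _)]

/-- An invariant `a` commutes with `𝔤₂`, hence with `E` and with the projection to `x₁ s`; so it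
acts on `x₁ s` through `ℝ[θ]`. As `𝔤₂` carries `x₁ s` to every other `x_k s`, the same `r, s` serve
for all `k`. -/
theorem exists_mul_cliffGen_mul_spinorProj {a : Cliff 7} (ha : a ∈ fixedSubalgebra g2Action) :
    ∃ r s : ℝ, ∀ k, a * (cliffGen k * spinorProj) =
      (r • 1 + s • cliffTheta) * (cliffGen k * spinorProj) := by
  have hs := spinGen_mul_comm_of_fixed ha
  have hss (k b) : spinGen k b * spinGen k b * a = a * (spinGen k b * spinGen k b) := by
    rw [mul_assoc, hs, ← mul_assoc, hs, mul_assoc]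
  have hE : spinorProj * a = a * spinorProj := by
    have h1 := congrArg (· * a) sum_spinGen_mul_self
    have h2 := congrArg (a * ·) sum_spinGen_mul_self
    simp only [Finset.sum_mul, Finset.mul_sum, hss] at h1 h2
    have h3 := h1.symm.trans h2
    rw [sub_mul, mul_sub, smul_one_mul, mul_smul_one, sub_left_inj, smul_mul_assoc,
      mul_smul_comm] at h3
    exact smul_right_injective _ (by norm_num : (6 : ℝ) ≠ 0) h3
  have h0 : cliffGen 0 * spinorProj * cliffGen 0 * a = a * (cliffGen 0 * spinorProj * cliffGen 0) := by
    rw [cliffGen_zero_mul_spinorProj_mul]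
    simp only [sub_mul, mul_sub, Finset.sum_mul, Finset.mul_sum, hss, hE, smul_one_mul,
      mul_smul_one]
  -- `a` commutes with `x₁ E x₁`, so `-8 a x₁ E = x₁ E x₁ a x₁ E`, and the part after the first `x₁`
  -- lies in the corner.
  obtain ⟨r, s, hrs⟩ := spinorProj_mul_mul_spinorProj (cliffGen 0 * a * cliffGen 0)
  have h1 : (-8 : ℝ) • (a * (cliffGen 0 * spinorProj)) =
      cliffGen 0 * (r • spinorProj + s • (cliffTheta * spinorProj)) := by
    rw [← hrs]
    have h2 := congrArg (· * (cliffGen 0 * spinorProj)) h0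
    have h3 : a * (cliffGen 0 * spinorProj * cliffGen 0) * (cliffGen 0 * spinorProj) =
        a * (cliffGen 0 * (spinorProj * (cliffGen 0 * cliffGen 0) * spinorProj)) := by
      simp only [mul_assoc]
    simp only [h3, cliffGen_mul_self, mul_one, neg_mul, spinorProj_mul_self, mul_neg,
      mul_smul_comm] at h2
    rw [neg_smul, ← h2]
    simp only [mul_assoc]
  have h2 : a * (cliffGen 0 * spinorProj) =
      ((-r / 8) • 1 + (-s / 8) • cliffTheta) * (cliffGen 0 * spinorProj) := by
    apply smul_right_injective _ (by norm_num : (-8 : ℝ) ≠ 0)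
    change (-8 : ℝ) • _ = (-8 : ℝ) • _
    rw [h1, smul_one_add_smul_theta_mul, mul_add, mul_smul_comm, mul_smul_comm,
      ← mul_assoc (cliffGen 0), ← cliffTheta_mul, mul_assoc]
    module
  refine ⟨-r / 8, -s / 8, fun k => ?_⟩
  by_cases hk : k = 0
  · rw [hk, h2]
  · obtain ⟨l, b, hlb⟩ := exists_spinGen_mul_cliffGen_zero k hk
    apply smul_right_injective _ (by norm_num : (2 : ℝ) ≠ 0)
    change (2 : ℝ) • _ = (2 : ℝ) • _
    rw [← mul_smul_comm (2 : ℝ) a, ← mul_smul_comm (2 : ℝ) (_ + _), ← hlb, ← mul_assoc a, ← hs, mul_assoc, h2,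
      ← mul_assoc (spinGen l b), ← mul_assoc (_ + _) (spinGen l b)]
    congr 1
    rw [mul_add, add_mul, mul_smul_one, smul_one_mul, smul_mul_assoc, mul_smul_comm,
      cliffTheta_mul]

/-! ### The basis of the invariant algebra -/

theorem cliffTheta_mul_cliffEpsilon_mul_spinorProj :
    cliffTheta * cliffEpsilon * spinorProj = (-7 : ℝ) • spinorProj := by
  rw [mul_assoc, cliffEpsilon_mul_spinorProj, mul_smul_comm, ← mul_assoc, cliffTheta_mul_self,
    one_mul]

theorem cliffTheta_mul_cliffEpsilon_mul_cliffGen (k : Fin 7) :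
    cliffTheta * cliffEpsilon * (cliffGen k * spinorProj) = cliffGen k * spinorProj := by
  rw [mul_assoc, cliffEpsilon_mul_cliffGen_mul_spinorProj, ← mul_assoc, cliffTheta_mul_self,
    one_mul]

theorem combination_mul_spinorProj (p q r s : ℝ) :
    (p • 1 + q • cliffEpsilon + r • (cliffTheta * cliffEpsilon) + s • cliffTheta) * spinorProj =
      (p - 7 * r) • spinorProj + (s - 7 * q) • (cliffTheta * spinorProj) := by
  simp only [add_mul, smul_mul_assoc, one_mul, cliffTheta_mul_cliffEpsilon_mul_spinorProj,
    cliffEpsilon_mul_spinorProj]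
  module

theorem combination_mul_cliffGen_mul_spinorProj (p q r s : ℝ) (k : Fin 7) :
    (p • 1 + q • cliffEpsilon + r • (cliffTheta * cliffEpsilon) + s • cliffTheta) *
        (cliffGen k * spinorProj) =
      (p + r) • (cliffGen k * spinorProj) + (s + q) • (cliffTheta * (cliffGen k * spinorProj)) := by
  simp only [add_mul, smul_mul_assoc, one_mul, cliffTheta_mul_cliffEpsilon_mul_cliffGen,
    cliffEpsilon_mul_cliffGen_mul_spinorProj]
  module

theorem linearIndependent_invariants :
    LinearIndependent ℝ ![1, cliffEpsilon, cliffTheta * cliffEpsilon, cliffTheta] := by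
  rw [Fintype.linearIndependent_iff]
  intro c hc
  simp only [Fin.sum_univ_four, Matrix.cons_val] at hc
  have h1 := combination_mul_spinorProj (c 0) (c 1) (c 2) (c 3)
  have h2 := combination_mul_cliffGen_mul_spinorProj (c 0) (c 1) (c 2) (c 3) 0
  rw [hc, zero_mul] at h1 h2
  obtain ⟨h3, h4⟩ := cliffTheta_mul_spinorProj_cancel h1.symm
  -- Multiplication by `-x₁ = x₁⁻¹` turns the relation on `x₁ E` into one on `E`.
  have h5 := congrArg (-cliffGen 0 * ·) h2
  simp only [mul_zero, mul_add, mul_smul_comm] at h5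
  rw [← mul_assoc (-cliffGen 0) cliffTheta, ← cliffTheta_mul, mul_assoc cliffTheta,
    ← mul_assoc, neg_mul, cliffGen_mul_self, neg_neg, one_mul] at h5
  obtain ⟨h6, h7⟩ := cliffTheta_mul_spinorProj_cancel h5.symm
  intro i
  fin_cases i <;> simp <;> linarith

theorem span_invariants :
    Submodule.span ℝ (Set.range ![1, cliffEpsilon, cliffTheta * cliffEpsilon, cliffTheta]) =
      Subalgebra.toSubmodule (fixedSubalgebra g2Action) := by
  apply le_antisymm
  · rw [Submodule.span_le]
    rintro _ ⟨i, rfl⟩ g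
    fin_cases i
    · exact map_one _
    · exact g2Action_cliffEpsilon g
    · change g2Action g (cliffTheta * cliffEpsilon) = cliffTheta * cliffEpsilon
      rw [map_mul, g2Action_cliffTheta, g2Action_cliffEpsilon]
    · exact g2Action_cliffTheta g
  · intro a ha
    obtain ⟨r, s, h0⟩ := exists_mul_spinorProj_of_mem_lifts (fixed_le_lifts _ ha)
    obtain ⟨p, q, h⟩ := exists_mul_cliffGen_mul_spinorProj ha
    -- The coefficients solve the equations that compare the actions on `E` (where `θ ε` is `-7`)
    -- and on the `x_k E` (where it is `1`), separately for the even and the odd pair.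
    have : a = (p - (p - r) / 8) • 1 + ((q - s) / 8) • cliffEpsilon +
        ((p - r) / 8) • (cliffTheta * cliffEpsilon) + (q - (q - s) / 8) • cliffTheta := by
      refine eq_of_mul_spinorProj ?_ fun k => ?_
      · rw [h0, combination_mul_spinorProj, smul_one_add_smul_theta_mul]
        module
      · rw [h, combination_mul_cliffGen_mul_spinorProj, smul_one_add_smul_theta_mul]
        module
    rw [this]
    have hm (i : Fin 4) : ![1, cliffEpsilon, cliffTheta * cliffEpsilon, cliffTheta] i ∈
        Submodule.span ℝ (Set.range ![1, cliffEpsilon, cliffTheta * cliffEpsilon, cliffTheta]) :=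
      Submodule.subset_span ⟨i, rfl⟩
    exact add_mem (add_mem (add_mem (Submodule.smul_mem _ _ (hm 0)) (Submodule.smul_mem _ _ (hm 1)))
      (Submodule.smul_mem _ _ (hm 2))) (Submodule.smul_mem _ _ (hm 3))

end Invariants

/-! ### The reduction -/

section Reduction

attribute [local instance] LieRing.ofAssociativeRing

/-- An endomorphism of a cyclic module is right multiplication by a lift `b` of the image of `1`.
Since `E - 8` is in the ideal, `(E - 8) b E = 0`, so `b` may be replaced by an element of `ℝ[θ]`,
which is invariant. -/
theorem rightAction_bijective : Function.Bijective g2Comoment.rightAction := by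
  constructor
  · rw [injective_iff_map_eq_zero]
    intro x hx
    obtain ⟨b, rfl⟩ := Ideal.Quotient.mk_surjective x
    have h := g2Comoment.rightAction_mk b 1
    rw [hx, one_mul] at h
    have hb : (b : Cliff 7) ∈ g2Comoment.leftIdeal := (Submodule.Quotient.mk_eq_zero _).1 h.symm
    exact Ideal.Quotient.eq_zero_iff_mem.2 hb
  · intro T
    obtain ⟨b, hb⟩ := Submodule.Quotient.mk_surjective _ (T.unop (Submodule.Quotient.mk 1))
    have hT (a : Cliff 7) : T.unop (Submodule.Quotient.mk a) = Submodule.Quotient.mk (a * b) := by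
      have : (Submodule.Quotient.mk a : g2Comoment.Quot) = a • Submodule.Quotient.mk 1 := by
        rw [← Submodule.Quotient.mk_smul, smul_eq_mul, mul_one]
      rw [this, map_smul, ← hb, ← Submodule.Quotient.mk_smul, smul_eq_mul]
    have h0 : spinorProj - (8 : ℝ) • 1 ∈ g2Comoment.leftIdeal := by
      rw [mem_g2Comoment_leftIdeal, sub_mul, spinorProj_mul_self, smul_one_mul, sub_self]
    have h1 := hT (spinorProj - (8 : ℝ) • 1)
    rw [(Submodule.Quotient.mk_eq_zero _).2 h0, map_zero, eq_comm, Submodule.Quotient.mk_eq_zero,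
      mem_g2Comoment_leftIdeal, mul_assoc] at h1
    obtain ⟨r, s, h⟩ := mul_spinorProj_of_mul_eq h1
    refine ⟨Ideal.Quotient.mk _
      ⟨_, fixed_le_lifts g2Comoment (smul_one_add_smul_theta_mem_fixed r s)⟩, ?_⟩
    apply MulOpposite.unop_injective
    apply LinearMap.ext
    intro x
    obtain ⟨a, rfl⟩ := Submodule.Quotient.mk_surjective _ x
    rw [g2Comoment.rightAction_mk, hT, Submodule.Quotient.eq, mem_g2Comoment_leftIdeal, sub_mul,
      mul_assoc, mul_assoc, h, sub_self]

/-! ### The isomorphism with `Cliff(-1)` and its grading -/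

theorem cliffNegGen_mul_self {n : ℕ} (i : Fin n) :
    (cliffNegGen i * cliffNegGen i : CliffNeg n) = 1 := by
  rw [cliffNegGen, CliffordAlgebra.ι_sq_scalar]
  simp [QuadraticMap.weightedSumSquares_apply, Pi.single_apply]

theorem ι_cliffNeg_one (v : Fin 1 → ℝ) :
    (CliffordAlgebra.ι _ v : CliffNeg 1) = v 0 • cliffNegGen 0 := by
  rw [cliffNegGen, ← map_smul, ← Pi.single_smul, smul_eq_mul, mul_one]
  congr 1
  ext i
  fin_cases i
  simp

theorem cliffNeg_one_eq (c : CliffNeg 1) : ∃ r s : ℝ, c = r • 1 + s • cliffNegGen 0 := by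
  induction c using CliffordAlgebra.left_induction with
  | algebraMap r => exact ⟨r, 0, by rw [Algebra.algebraMap_eq_smul_one, zero_smul, add_zero]⟩
  | add a b ha hb =>
    obtain ⟨r, s, rfl⟩ := ha
    obtain ⟨r', s', rfl⟩ := hb
    exact ⟨r + r', s + s', by module⟩
  | ι_mul a v ha =>
    obtain ⟨r, s, rfl⟩ := ha
    refine ⟨v 0 * s, v 0 * r, ?_⟩
    rw [ι_cliffNeg_one, mul_add, mul_smul_one, smul_mul_assoc, mul_smul_comm, cliffNegGen_mul_self]
    module

theorem cliffTheta_mem_lifts (μ : G2ComomentMap) : cliffTheta ∈ μ.lifts :=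
  fixed_le_lifts μ g2Action_cliffTheta

/-- The algebra map from `Cliff(-1)` that sends the generator to `θ`. -/
noncomputable def thetaHom : CliffNeg 1 →ₐ[ℝ] g2Comoment.lifts :=
  CliffordAlgebra.lift _ ⟨(LinearMap.proj 0 : (Fin 1 → ℝ) →ₗ[ℝ] ℝ).smulRight
    ⟨cliffTheta, cliffTheta_mem_lifts g2Comoment⟩, fun v => Subtype.ext (by
      change (v 0 • cliffTheta) * (v 0 • cliffTheta) = algebraMap ℝ (Cliff 7) _
      rw [smul_mul_smul_comm, cliffTheta_mul_self, Algebra.algebraMap_eq_smul_one]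
      simp [QuadraticMap.weightedSumSquares_apply])⟩

theorem thetaHom_gen :
    thetaHom (cliffNegGen 0) = ⟨cliffTheta, cliffTheta_mem_lifts g2Comoment⟩ := by
  rw [thetaHom, cliffNegGen, CliffordAlgebra.lift_ι_apply]
  simp

theorem thetaHom_apply (r s : ℝ) :
    (thetaHom (r • 1 + s • cliffNegGen 0) : Cliff 7) = r • 1 + s • cliffTheta := by
  rw [map_add, map_smul, map_smul, map_one, thetaHom_gen]
  rfl

theorem thetaHom_commutes (c : CliffNeg 1) (a : Cliff 7) :
    (thetaHom c : Cliff 7) * a = a * thetaHom c := by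
  obtain ⟨r, s, rfl⟩ := cliffNeg_one_eq c
  rw [thetaHom_apply, smul_one_add_smul_theta_mul, mul_add, mul_smul_one, mul_smul_comm,
    cliffTheta_mul]

theorem involute_thetaHom (c : CliffNeg 1) :
    CliffordAlgebra.involute (thetaHom c : Cliff 7) = thetaHom (CliffordAlgebra.involute c) := by
  obtain ⟨r, s, rfl⟩ := cliffNeg_one_eq c
  have h : CliffordAlgebra.involute (cliffNegGen 0 : CliffNeg 1) = -cliffNegGen 0 :=
    CliffordAlgebra.involute_ι _
  have h' : CliffordAlgebra.involute (r • 1 + s • cliffNegGen 0 : CliffNeg 1) =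
      r • 1 + (-s) • cliffNegGen 0 := by
    rw [map_add, map_smul, map_smul, map_one, h, smul_neg, neg_smul]
  rw [h', thetaHom_apply, thetaHom_apply, map_add, map_smul, map_smul, map_one, involute_cliffTheta, smul_neg, neg_smul]

theorem thetaHom_mem (i : ZMod 2) {c : CliffNeg 1} (hc : c ∈ cliffNegGrading 1 i) :
    (thetaHom c : Cliff 7) ∈ cliffGrading 7 i := by
  fin_cases i
  · exact mem_even_of_involute (by
      rw [involute_thetaHom, CliffordAlgebra.involute_eq_of_mem_even hc])
  · exact mem_odd_of_involute (by
      rw [involute_thetaHom, CliffordAlgebra.involute_eq_of_mem_odd hc, map_neg]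
      rfl)

theorem eq_zero_of_thetaHom_mul {c : CliffNeg 1}
    (h : (thetaHom c : Cliff 7) * spinorProj = 0) : c = 0 := by
  obtain ⟨r, s, rfl⟩ := cliffNeg_one_eq c
  rw [thetaHom_apply, smul_one_add_smul_theta_mul] at h
  obtain ⟨rfl, rfl⟩ := cliffTheta_mul_spinorProj_cancel h
  simp

/-- A homogeneous element whose product with the spinor projection is in `ℝ[θ] E` is represented
by a homogeneous element of `Cliff(-1)`. -/
theorem exists_homogeneous_thetaHom (i : ZMod 2) {a : Cliff 7} (ha : a ∈ cliffGrading 7 i)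
    {r s : ℝ} (h : a * spinorProj = (r • 1 + s • cliffTheta) * spinorProj) :
    ∃ c ∈ cliffNegGrading 1 i, a * spinorProj = thetaHom c * spinorProj := by
  -- The grading involution fixes `E` and negates `θ`; comparison with `h` removes the coefficient
  -- of the wrong parity.
  have hi := congrArg CliffordAlgebra.involute h
  simp only [map_mul, map_add, map_smul, map_one, involute_cliffTheta, involute_spinorProj] at hi
  fin_cases i
  · rw [CliffordAlgebra.involute_eq_of_mem_even ha, h] at hi
    have h2 : (0 : ℝ) • spinorProj + (2 * s) • (cliffTheta * spinorProj) = 0 := by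
      rw [← sub_eq_zero] at hi
      rw [← hi]
      simp only [add_mul, smul_mul_assoc, one_mul, neg_mul, smul_neg]
      module
    have hs : s = 0 := by linarith [(cliffTheta_mul_spinorProj_cancel h2).2]
    refine ⟨r • 1 + (0 : ℝ) • cliffNegGen 0, ?_, ?_⟩
    · rw [zero_smul, add_zero]
      exact Submodule.smul_mem _ _ (Submodule.one_le.1 (CliffordAlgebra.one_le_evenOdd_zero _))
    · rw [thetaHom_apply, h, hs]
  · rw [CliffordAlgebra.involute_eq_of_mem_odd ha, neg_mul, h] at hi
    have h2 : (2 * r) • spinorProj + (0 : ℝ) • (cliffTheta * spinorProj) = 0 := by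
      rw [eq_comm, ← sub_eq_zero, sub_neg_eq_add] at hi
      rw [← hi]
      simp only [add_mul, smul_mul_assoc, one_mul, neg_mul, smul_neg]
      module
    have hr : r = 0 := by linarith [(cliffTheta_mul_spinorProj_cancel h2).1]
    refine ⟨(0 : ℝ) • 1 + s • cliffNegGen 0, ?_, ?_⟩
    · rw [zero_smul, zero_add]
      exact Submodule.smul_mem _ _ (CliffordAlgebra.ι_mem_evenOdd_one _ _)
    · rw [thetaHom_apply, h, hr]

/-- The algebra map from `Cliff(-1)` to the reduction. -/
noncomputable def reductionHom : CliffNeg 1 →ₐ[ℝ] g2Comoment.Reduction :=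
  (Ideal.Quotient.mkₐ ℝ g2Comoment.liftsIdeal).comp thetaHom

theorem mk_eq_reductionHom {b : g2Comoment.lifts} {c : CliffNeg 1}
    (h : (b : Cliff 7) * spinorProj = thetaHom c * spinorProj) :
    Ideal.Quotient.mk g2Comoment.liftsIdeal b = reductionHom c := by
  refine (Ideal.Quotient.eq).2 ?_
  change (b : Cliff 7) - thetaHom c ∈ g2Comoment.leftIdeal
  rw [mem_g2Comoment_leftIdeal, sub_mul, h, sub_self]

theorem reductionHom_bijective : Function.Bijective reductionHom := by
  constructor
  · rw [injective_iff_map_eq_zero]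
    intro c hc
    have h : thetaHom c ∈ g2Comoment.liftsIdeal := Ideal.Quotient.eq_zero_iff_mem.1 hc
    exact eq_zero_of_thetaHom_mul (mem_g2Comoment_leftIdeal.1 h)
  · intro x
    obtain ⟨b, rfl⟩ := Ideal.Quotient.mk_surjective x
    obtain ⟨r, s, h⟩ := exists_mul_spinorProj_of_mem_lifts b.2
    exact ⟨r • 1 + s • cliffNegGen 0, (mk_eq_reductionHom (by rw [thetaHom_apply, h])).symm⟩

/-- The reduction is `Cliff(-1)`. -/
noncomputable def reductionEquiv : CliffNeg 1 ≃ₐ[ℝ] g2Comoment.Reduction :=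
  AlgEquiv.ofBijective reductionHom reductionHom_bijective

theorem reductionEquiv_apply (c : CliffNeg 1) :
    reductionEquiv c = Ideal.Quotient.mk g2Comoment.liftsIdeal (thetaHom c) := rfl

/-- Equality of the gradings also needs that a class with a homogeneous lift in `Cliff(7)` comes
from a homogeneous element of `Cliff(-1)` of the same degree. -/
theorem map_reductionEquiv (i : ZMod 2) :
    (cliffNegGrading 1 i).map reductionEquiv.toLinearMap = g2Comoment.reductionGrading i := by
  apply le_antisymm
  · rintro _ ⟨c, hc, rfl⟩
    exact ⟨thetaHom c, thetaHom_mem i hc, rfl⟩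
  · rintro _ ⟨b, hb, rfl⟩
    obtain ⟨r, s, h⟩ := exists_mul_spinorProj_of_mem_lifts b.2
    obtain ⟨c, hc, h'⟩ := exists_homogeneous_thetaHom i hb h
    exact ⟨c, hc, (mk_eq_reductionHom h').symm⟩

theorem spinorProj_mem_even : spinorProj ∈ cliffGrading 7 0 :=
  mem_even_of_involute involute_spinorProj

/-- A right action of a superalgebra that factors through `Cliff(-1)` and the central element `θ`
makes the bimodule of the reduction a Morita equivalence. -/
theorem isMoritaEquivalence_of_thetaHom {B : Type} [Ring B] [Algebra ℝ B]
    {ℬ : ZMod 2 → Submodule ℝ B} (f : B ≃ₐ[ℝ] CliffNeg 1)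
    (hf : ∀ i b, b ∈ ℬ i ↔ f b ∈ cliffNegGrading 1 i) (M : SuperBimodule (cliffGrading 7) ℬ)
    (m₀ : M.carrier) (hgen : ∀ i, ∀ m ∈ M.grading i, ∃ a ∈ cliffGrading 7 i, m = a • m₀)
    (hann : ∀ a : Cliff 7, a • m₀ = 0 ↔ a * spinorProj = 0)
    (hright : ∀ b, (M.right b).unop m₀ = (thetaHom (f b) : Cliff 7) • m₀) :
    M.IsMoritaEquivalence := by
  have h8 : (8⁻¹ : ℝ) ≠ 0 := by norm_num
  -- `none` contributes the term `E` and `some k` the term `-x_k E x_k` of the resolution of the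
  -- identity.
  refine M.isMoritaEquivalence_of_idempotent (e := (8⁻¹ : ℝ) • spinorProj)
    (u := fun o : Option (Fin 7) => o.elim 1 cliffGen)
    (v := fun o => o.elim 1 fun k => -cliffGen k) ?_ ?_ ?_
    (g2Comoment.lifts.val.comp (thetaHom.comp f.toAlgHom)) ?_ ?_ ?_ ?_ m₀ hgen ?_ hright
  · rw [smul_mul_smul_comm, spinorProj_mul_self, smul_smul]
    norm_num
  · exact Submodule.smul_mem _ _ spinorProj_mem_even
  · rw [Fintype.sum_option]
    simp only [Option.elim_none, Option.elim_some, one_mul, mul_one, mul_neg, mul_smul_comm,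
      smul_mul_assoc, Finset.sum_neg_distrib, ← Finset.smul_sum]
    rw [← sub_eq_add_neg, ← smul_sub, spinorProj_sub_sum, smul_smul]
    norm_num
  · exact fun b a => thetaHom_commutes (f b) a
  · exact fun i b hb => thetaHom_mem i ((hf i b).1 hb)
  · intro i x hx
    have hx' : (8⁻¹ : ℝ) • spinorProj * x ∈ cliffGrading 7 i := zero_add i ▸
      SetLike.mul_mem_graded (Submodule.smul_mem _ _ spinorProj_mem_even) hx
    -- Applied to `e x`: it satisfies the hypothesis because `(E - 8) e = 0`.
    obtain ⟨r, s, h⟩ := mul_spinorProj_of_mul_eq (a := (8⁻¹ : ℝ) • spinorProj * x) (by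
      rw [← mul_assoc, ← mul_assoc, sub_mul, mul_smul_comm, spinorProj_mul_self, smul_one_mul,
        smul_comm, sub_self, zero_mul, zero_mul])
    obtain ⟨c, hc, h'⟩ := exists_homogeneous_thetaHom i hx' h
    refine ⟨f.symm c, (hf _ _).2 (by rwa [f.apply_symm_apply]), ?_⟩
    change _ = (thetaHom (f (f.symm c)) : Cliff 7) * _
    rw [f.apply_symm_apply, mul_smul_comm, h', mul_smul_comm]
  · intro b hb
    change (thetaHom (f b) : Cliff 7) * _ = 0 at hb
    rw [mul_smul_comm] at hb
    exact (map_eq_zero_iff f f.injective).1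
      (eq_zero_of_thetaHom_mul ((smul_eq_zero.1 hb).resolve_left h8))
  · intro a
    rw [hann, mul_smul_comm, smul_eq_zero_iff_right h8]

theorem bimodule_generator (i : ZMod 2) (m : g2Comoment.Quot) (hm : m ∈ g2Comoment.quotGrading i) :
    ∃ a ∈ cliffGrading 7 i, m = a • (Submodule.Quotient.mk 1 : g2Comoment.Quot) := by
  obtain ⟨a, ha, rfl⟩ := hm
  refine ⟨a, ha, ?_⟩
  rw [← Submodule.Quotient.mk_smul, smul_eq_mul, mul_one]
  rfl

theorem smul_generator_eq_zero (a : Cliff 7) :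
    a • (Submodule.Quotient.mk 1 : g2Comoment.Quot) = 0 ↔ a * spinorProj = 0 := by
  rw [← Submodule.Quotient.mk_smul, smul_eq_mul, mul_one, Submodule.Quotient.mk_eq_zero,
    mem_g2Comoment_leftIdeal]

theorem rightAction_generator (c : CliffNeg 1) :
    (g2Comoment.rightAction (reductionEquiv c)).unop (Submodule.Quotient.mk 1) =
      (thetaHom c : Cliff 7) • (Submodule.Quotient.mk 1 : g2Comoment.Quot) := by
  rw [reductionEquiv_apply, g2Comoment.rightAction_mk, ← Submodule.Quotient.mk_smul, smul_eq_mul,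
    one_mul, mul_one]

theorem bimodule_isMoritaEquivalence : g2Comoment.bimodule.IsMoritaEquivalence := by
  refine isMoritaEquivalence_of_thetaHom reductionEquiv.symm (fun i b => ?_) _
    (Submodule.Quotient.mk 1 : g2Comoment.Quot) bimodule_generator smul_generator_eq_zero
    fun b => ?_
  · rw [← map_reductionEquiv]
    constructor
    · rintro ⟨c, hc, rfl⟩
      change reductionEquiv.symm (reductionEquiv c) ∈ _
      rwa [AlgEquiv.symm_apply_apply]
    · exact fun h => ⟨_, h, reductionEquiv.apply_symm_apply b⟩
  · have := rightAction_generator (reductionEquiv.symm b)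
    rw [AlgEquiv.apply_symm_apply] at this
    exact this

end Reduction

theorem theorem4p1 :
    -- there is exactly one comoment map for the action of `G₂` on `Cliff(7)`
    (∃ μ₀ : G2ComomentMap, ∀ μ : G2ComomentMap, μ = μ₀) ∧
    -- the `G₂`-invariants of `Cliff(7)` have basis `1, ε, θ ε, θ`
    (LinearIndependent ℝ ![1, cliffEpsilon, cliffTheta * cliffEpsilon, cliffTheta] ∧
      Submodule.span ℝ (Set.range ![1, cliffEpsilon, cliffTheta * cliffEpsilon, cliffTheta]) =
        Subalgebra.toSubmodule (fixedSubalgebra g2Action)) ∧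
    ∀ μ : G2ComomentMap,
      -- the action of `G₂` descends to `Cliff(7) / ⟨μ 𝔤₂⟩`
      (∀ g, ∀ a ∈ μ.leftIdeal, g2Action g a ∈ μ.leftIdeal) ∧
      -- every `G₂`-invariant class has a `G₂`-invariant representative
      (∀ a ∈ μ.lifts, ∃ b ∈ fixedSubalgebra g2Action, a - b ∈ μ.leftIdeal) ∧
      -- `Cliff(7) // G₂` is `End_{Cliff(7)} (Cliff(7) / ⟨μ 𝔤₂⟩)`
      Function.Bijective μ.rightAction ∧
      -- `Cliff(7) / ⟨μ 𝔤₂⟩` is a Morita equivalence between `Cliff(7)` and `Cliff(7) // G₂`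
      μ.bimodule.IsMoritaEquivalence ∧
      -- `Cliff(-1) ≅ Cliff(7) // G₂` as superalgebras, with the generator going to the class of `θ`,
      -- and so `Cliff(7) / ⟨μ 𝔤₂⟩` is a Morita equivalence between `Cliff(7)` and `Cliff(-1)`
      ∃ (Φ : CliffNeg 1 ≃ₐ[ℝ] μ.Reduction)
        (hΦ : ∀ i, (cliffNegGrading 1 i).map Φ.toLinearMap = μ.reductionGrading i),
        (∃ hθ : cliffTheta ∈ μ.lifts, Φ (cliffNegGen 0) = Ideal.Quotient.mk μ.liftsIdeal ⟨cliffTheta, hθ⟩) ∧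
        (μ.bimodule.restrictRight (𝒞 := cliffNegGrading 1) Φ.toAlgHom
          (fun i _ hc => hΦ i ▸ Submodule.mem_map_of_mem hc)).IsMoritaEquivalence := by
  refine ⟨⟨g2Comoment, g2ComomentMap_eq⟩, ⟨linearIndependent_invariants, span_invariants⟩, ?_⟩
  intro μ
  -- By uniqueness, the remaining claims concern only the explicit comoment map.
  obtain rfl := g2ComomentMap_eq μ
  refine ⟨fun g a => g2Action_mem_leftIdeal g, fun a ha => ?_, rightAction_bijective,
    bimodule_isMoritaEquivalence, reductionEquiv, map_reductionEquiv,
    ⟨cliffTheta_mem_lifts g2Comoment, ?_⟩, ?_⟩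
  · obtain ⟨r, s, h⟩ := exists_fixed_of_mem_lifts ha
    exact ⟨_, smul_one_add_smul_theta_mem_fixed r s, h⟩
  · rw [reductionEquiv_apply, thetaHom_gen]
  · exact isMoritaEquivalence_of_thetaHom AlgEquiv.refl (fun i b => Iff.rfl) _
      (Submodule.Quotient.mk 1 : g2Comoment.Quot) bimodule_generator smul_generator_eq_zero
      rightAction_generator
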